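/- Let $N\ge 1$ and let $\mathsf S=\mathsf A_1\cdots\mathsf A_N$ be a finite-dimensional $N$-partite quantum system with Hamiltonian $H=\sum_{k=1}^N \mathbb 1^{\otimes(k-1)}\otimes H_k\otimes \mathbb 1^{\otimes(N-k)}$, where each $H_k$ is Hermitian, and let $\beta>0$. For a state $\rho$ of $\mathsf S$ write $\rho_k$ for its reduced state on $\mathsf A_k$; let $S(\rho)=-\operatorname{tr}[\rho\log\rho]$ and $F_\beta(\rho)=\operatorname{tr}[H\rho]-S(\rho)/\beta$, and define $F_\beta(\rho_k)$ likewise with $H_k$. Define the chain of conditional entropies $$C(\rho)=\sum_{k=1}^{N-1}S(\mathsf A_k|\mathsf A_{k+1}\cdots\mathsf A_N)_\rho,\qquad S(\mathsf A_k|\mathsf A_{k+1}\cdots\mathsf A_N)_\rho=S(\rho_{\mathsf A_k\cdots\mathsf A_N})-S(\rho_{\mathsf A_{k+1}\cdots\mathsf A_N}).$$ Let $Q_c(\rho)$ and $Q_h(\rho)$ be the minimum and the maximum of $\operatorname{tr}[H(\rho-\eta)]$ over all states $\eta$ of $\mathsf S$ with $F_\beta(\eta)\le F_\beta(\rho)$.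 A state is separable if it is a convex combination of product states $\sigma_1\otimes\cdots\otimes\sigma_N$. Put $\gamma(x)=e^{-xH}/\operatorname{tr}e^{-xH}$ for $x\in\mathbb R$. (1) For every state $\rho$, $$S(\rho)=S(\rho_N)+C(\rho),\qquad F_\beta(\rho)=\sum_{k=1}^N F_\beta(\rho_k)+\frac1\beta\Big[\sum_{k=1}^{N-1}S(\rho_k)-C(\rho)\Big].$$ (2) If $\rho$ is separable, then $C(\rho)\ge 0$. (3) Fix real numbers $E_k,s_k$ such that the set $\mathrm{SEP}$ of separable states $\rho$ with $\operatorname{tr}[H_k\rho_k]=E_k$ and $S(\rho_k)=s_k$ for all $k$ is non-empty. Let $$F^\star=\sum_{k=1}^N\Big(E_k-\frac{s_k}\beta\Big)+\frac1\beta\sum_{k=1}^{N-1}s_k$$ be the value of the free energy in (1) when the chain is set to zero, and let $Q_c^\star$ and $Q_h^\star$ be the minimum and the maximum of $\sum_kE_k-\operatorname{tr}[H\eta]$ over states $\eta$ with $F_\beta(\eta)\le F^\star$. All these minima and maxima, and the classical heats $Q^{\rm class}_c=\min_{\rho\in\mathrm{SEP}}Q_c(\rho)$ and $Q^{\rm class}_h=\max_{\rho\in\mathrm{SEP}}Q_h(\rho)$,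 are attained. For every $\rho\in\mathrm{SEP}$ one has $F_\beta(\rho)\le F^\star$, with equality if and only if $C(\rho)=0$, and $$Q_c^\star\le Q_c(\rho)\le q\le Q_h(\rho)\le Q_h^\star$$ for the heat $q=\operatorname{tr}[H_{\mathsf E}(\eta_{\mathsf E}-\gamma_{\mathsf E})]$ of every process in which $\rho\otimes\omega_{\mathsf M}\otimes\gamma_{\mathsf E}$ evolves under a unitary $U$ with $[U,H+H_{\mathsf M}+H_{\mathsf E}]=0$ and $\eta_{\mathsf M}=\omega_{\mathsf M}$, where the memory $\mathsf M$ and the environment $\mathsf E$ are finite-dimensional, $\gamma_{\mathsf E}$ is thermal at inverse temperature $\beta$, and $\eta_{\mathsf M},\eta_{\mathsf E}$ are the reduced final states. Hence $Q_c^\star\le Q_c^{\rm class}$ and $Q_h^{\rm class}\le Q_h^\star$. If some $\rho\in\mathrm{SEP}$ has $C(\rho)=0$, then $Q_{c/h}(\rho)=Q_{c/h}^{\rm class}=Q_{c/h}^\star$. (4) In the setting of (3), consider the zeros $x$ of $f(x)=F^\star-F_\beta(\gamma(x))$. If $\beta_c<\beta_h$ are two zeros, then $$Q_{c}^\star=\frac1\beta\big[s_N-S(\gamma(\beta_{c}))\big],\qquad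 Q_{h}^\star=\frac1\beta\big[s_N-S(\gamma(\beta_{h}))\big].$$ More generally the first formula holds for every zero $\beta_c\le\beta$ and the second for every zero $\beta_h\ge\beta$. If $f$ has no zero in $(-\infty,\beta]$, then $Q_c^\star=\sum_kE_k-\max\operatorname{spec}(H)$. If $f$ has no zero in $[\beta,\infty)$, then $Q_h^\star=\sum_kE_k-\min\operatorname{spec}(H)$. -/

import Mathlib

open scoped Kronecker ComplexOrder

namespace HeatWitness

noncomputable section

/-! Finite-dimensional quantum systems: a system with orthonormal basis indexed by a finite type
`a` has operators `Matrix a a ℂ`. -/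

/-- Density operators: positive semidefinite with unit trace. -/
def IsState {a : Type*} [Fintype a] (ρ : Matrix a a ℂ) : Prop :=
  ρ.PosSemidef ∧ ρ.trace = 1

/-- Von Neumann entropy `S(ρ) = -tr[ρ log ρ]` (functional calculus, `log 0 = 0`, so that
`0 log 0 = 0`). -/
def entropy {a : Type*} [Fintype a] [DecidableEq a] (ρ : Matrix a a ℂ) : ℝ :=
  -(ρ * cfc Real.log ρ).trace.re

/-- Average energy `E(ρ) = tr[H ρ]`. -/
def energy {a : Type*} [Fintype a] (H ρ : Matrix a a ℂ) : ℝ :=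
  (H * ρ).trace.re

/-- Free energy `F_β(ρ) = E(ρ) - S(ρ) / β`. -/
def freeEnergy {a : Type*} [Fintype a] [DecidableEq a] (β : ℝ) (H ρ : Matrix a a ℂ) : ℝ :=
  energy H ρ - entropy ρ / β

/-- Thermal state `γ(x) = exp(-x H) / tr exp(-x H)`. -/
def gibbs {a : Type*} [Fintype a] [DecidableEq a] (x : ℝ) (H : Matrix a a ℂ) : Matrix a a ℂ :=
  (NormedSpace.exp ((-x) • H)).trace⁻¹ • NormedSpace.exp ((-x) • H)

/-- The function `f(x, y) = y - F_β(γ(x))`. -/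
def thermalGap {a : Type*} [Fintype a] [DecidableEq a] (β : ℝ) (H : Matrix a a ℂ)
    (x y : ℝ) : ℝ :=
  y - freeEnergy β H (gibbs x H)

/-- Partial trace over the second factor. -/
def traceOutRight {a b : Type*} [Fintype b] (M : Matrix (a × b) (a × b) ℂ) : Matrix a a ℂ :=
  Matrix.of fun i j => ∑ k, M (i, k) (j, k)

/-- Partial trace over the first factor. -/
def traceOutLeft {a b : Type*} [Fintype a] (M : Matrix (a × b) (a × b) ℂ) : Matrix b b ℂ :=
  Matrix.of fun i j => ∑ k, M (k, i) (k, j)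

/-! Heat exchange with a thermal environment. -/

/-- `q` is the heat `tr[H_E (η_E - γ_E)]` received by some finite-dimensional environment `E`,
initially thermal at inverse temperature `β`, in some energy-preserving unitary process on
system, memory `M` and environment that restores the state `ω` of the memory;
the system starts in `ρ` and has Hamiltonian `H`. -/
def IsProcessHeat {a : Type*} [Fintype a] [DecidableEq a] (β : ℝ) (H ρ : Matrix a a ℂ)
    (q : ℝ) : Prop :=
  ∃ (m e : ℕ) (HM ω : Matrix (Fin m) (Fin m) ℂ) (HE : Matrix (Fin e) (Fin e) ℂ)
    (U η : Matrix (a × Fin m × Fin e) (a × Fin m × Fin e) ℂ),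
    HM.IsHermitian ∧ HE.IsHermitian ∧ IsState ω ∧
    U ∈ Matrix.unitaryGroup (a × Fin m × Fin e) ℂ ∧
    Commute U (H ⊗ₖ (1 ⊗ₖ 1) + 1 ⊗ₖ (HM ⊗ₖ 1) + 1 ⊗ₖ (1 ⊗ₖ HE)) ∧
    η = U * (ρ ⊗ₖ (ω ⊗ₖ gibbs β HE)) * U.conjTranspose ∧
    traceOutRight (traceOutLeft η) = ω ∧
    q = (HE * (traceOutLeft (traceOutLeft η) - gibbs β HE)).trace.re

/-- The values of the objective `tr[H (ρ - η)]` of the optimal heat problem over the states `η`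
with `F_β(ρ) ≥ F_β(η)`. -/
def heatValues {a : Type*} [Fintype a] [DecidableEq a] (β : ℝ) (H ρ : Matrix a a ℂ) : Set ℝ :=
  {q | ∃ η : Matrix a a ℂ, IsState η ∧ freeEnergy β H η ≤ freeEnergy β H ρ ∧
    q = (H * (ρ - η)).trace.re}

/-- `Q_c(ρ)`, the minimum of `tr[H (ρ - η)]` subject to `F_β(ρ) ≥ F_β(η)`. -/
def Qc {a : Type*} [Fintype a] [DecidableEq a] (β : ℝ) (H ρ : Matrix a a ℂ) : ℝ :=
  sInf (heatValues β H ρ)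

/-- `Q_h(ρ)`, the maximum of `tr[H (ρ - η)]` subject to `F_β(ρ) ≥ F_β(η)`. -/
def Qh {a : Type*} [Fintype a] [DecidableEq a] (β : ℝ) (H ρ : Matrix a a ℂ) : ℝ :=
  sSup (heatValues β H ρ)

/-! Multipartite systems: the parties are `k : ι`, party `k` has basis `α k`, and the joint
system has the product basis `∀ k, α k`. -/

section Multipartite

variable {ι : Type*} [Fintype ι] [DecidableEq ι] {α : ι → Type*} [∀ k, Fintype (α k)]
  [∀ k, DecidableEq (α k)]

/-- Tensor product `⨂ₖ A k`. -/
def tensor (A : ∀ k, Matrix (α k) (α k) ℂ) : Matrix (∀ k, α k) (∀ k, α k) ℂ :=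
  Matrix.of fun x y => ∏ k, A k (x k) (y k)

/-- `∑ₖ 1 ⊗ ⋯ ⊗ 1 ⊗ h k ⊗ 1 ⊗ ⋯ ⊗ 1`, with `h k` in position `k`. -/
def totalHamiltonian (h : ∀ k, Matrix (α k) (α k) ℂ) : Matrix (∀ k, α k) (∀ k, α k) ℂ :=
  ∑ k, tensor (Pi.mulSingle k (h k))

/-- Reduced state `ρ_{A_k}` of party `k`. -/
def localState (k : ι) (ρ : Matrix (∀ k, α k) (∀ k, α k) ℂ) : Matrix (α k) (α k) ℂ :=
  traceOutRight (Matrix.reindex (Equiv.piSplitAt k α) (Equiv.piSplitAt k α) ρ)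

/-- Reduced state of the parties that satisfy `p`. -/
def marginal (p : ι → Prop) [DecidablePred p] (ρ : Matrix (∀ k, α k) (∀ k, α k) ℂ) :
    Matrix (∀ k : {k // p k}, α k) (∀ k : {k // p k}, α k) ℂ :=
  traceOutRight
    (Matrix.reindex (Equiv.piEquivPiSubtypeProd p α) (Equiv.piEquivPiSubtypeProd p α) ρ)

/-- (Fully) separable states: convex combinations of product states. -/
def IsSeparableState (ρ : Matrix (∀ k, α k) (∀ k, α k) ℂ) : Prop :=
  ρ ∈ convexHull ℝ {τ | ∃ σ : ∀ k, Matrix (α k) (α k) ℂ, (∀ k, IsState (σ k)) ∧ τ = tensor σ}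

end Multipartite

/-! Parties ordered as `A_0, …, A_n`. -/

section Chain

variable {n : ℕ} {α : Fin (n + 1) → Type*} [∀ k, Fintype (α k)] [∀ k, DecidableEq (α k)]

/-- Conditional entropy `S(A_k | A_{k+1} ⋯ A_n) = S(A_k A_{k+1} ⋯ A_n) - S(A_{k+1} ⋯ A_n)`. -/
def condEntropy (k : Fin n) (ρ : Matrix (∀ k, α k) (∀ k, α k) ℂ) : ℝ :=
  entropy (marginal (fun j => k.castSucc ≤ j) ρ) - entropy (marginal (fun j => k.castSucc < j) ρ)

/-- The chain of conditional entropies `∑_{k<n} S(A_k | A_{k+1} ⋯ A_n)`. -/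
def entropyChain (ρ : Matrix (∀ k, α k) (∀ k, α k) ℂ) : ℝ :=
  ∑ k : Fin n, condEntropy k ρ

/-- Separable states with prescribed local energies `E k` and local entropies `s k`. -/
def separableClass (h : ∀ k, Matrix (α k) (α k) ℂ) (E s : Fin (n + 1) → ℝ) :
    Set (Matrix (∀ k, α k) (∀ k, α k) ℂ) :=
  {ρ | IsSeparableState ρ ∧
    ∀ k, energy (h k) (localState k ρ) = E k ∧ entropy (localState k ρ) = s k}

/-- The free energy decomposition with the chain of conditional entropies set to zero,
`∑_{k≤n} (E k - s k / β) + β⁻¹ ∑_{k<n} s k`, as a function of local energies and entropies. -/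
def classicalFreeEnergy (β : ℝ) (E s : Fin (n + 1) → ℝ) : ℝ :=
  ∑ k, (E k - s k / β) + β⁻¹ * ∑ k : Fin n, s k.castSucc

/-- The values of the objective of the optimal heat problem for initial energy `∑ₖ E k`, where the
free energy of the initial state in the constraint is replaced by its value at zero chain. -/
def classicalHeatValues (β : ℝ) (h : ∀ k, Matrix (α k) (α k) ℂ) (E s : Fin (n + 1) → ℝ) :
    Set ℝ :=
  {q | ∃ η : Matrix (∀ k, α k) (∀ k, α k) ℂ, IsState η ∧
    freeEnergy β (totalHamiltonian h) η ≤ classicalFreeEnergy β E s ∧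
    q = ∑ k, E k - energy (totalHamiltonian h) η}

/-- Classical bound `Q_c^⋆`. -/
def QcStar (β : ℝ) (h : ∀ k, Matrix (α k) (α k) ℂ) (E s : Fin (n + 1) → ℝ) : ℝ :=
  sInf (classicalHeatValues β h E s)

/-- Classical bound `Q_h^⋆`. -/
def QhStar (β : ℝ) (h : ∀ k, Matrix (α k) (α k) ℂ) (E s : Fin (n + 1) → ℝ) : ℝ :=
  sSup (classicalHeatValues β h E s)

/-- Optimal classical heat: `Q_c` optimised over the separable class. -/
def QcClass (β : ℝ) (h : ∀ k, Matrix (α k) (α k) ℂ) (E s : Fin (n + 1) → ℝ) : ℝ :=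
  sInf (Qc β (totalHamiltonian h) '' separableClass h E s)

/-- Optimal classical heat: `Q_h` optimised over the separable class. -/
def QhClass (β : ℝ) (h : ∀ k, Matrix (α k) (α k) ℂ) (E s : Fin (n + 1) → ℝ) : ℝ :=
  sSup (Qh β (totalHamiltonian h) '' separableClass h E s)

end Chain

end

end HeatWitness

open HeatWitness

/-!
All quantum statements are reduced to finite sums over spectral data: a Hermitian matrix is written
`conjDiag U d = U diag(d) Uᴴ`, and a matrix `A` enters only through its occupations
`⟨v_j, A v_j⟩` in an orthonormal basis `V` (`occupation`). The estimate `log x ≤ x - 1`, averaged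
over the doubly stochastic matrix of squared overlaps of two eigenbases, gives the two entropy
inequalities that carry the proof.

* Klein's inequality with its equality case (`klein`). Relative to the thermal state it is the
  Gibbs variational principle (`entropy_le_gibbs`): `S(η) ≤ S(γ(x)) + x (E(η) - E(γ(x)))`, with
  equality only at `γ(x)`. Relative to the product of the marginals it is subadditivity of the
  entropy (`entropy_le_add`).
* If `ρ ≤ σ`, then `S(ρ) ≥ -tr[ρ log σ]` (`entropy_ge_of_le`). A separable state satisfies the
  reduction criterion `ρ_AB ≤ 1 ⊗ ρ_B`, because a product state does and the criterion is linear;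
  hence `S(A|B) ≥ 0` for separable states, and the chain of conditional entropies is nonnegative.
  The chain telescopes, which gives the decompositions of the entropy and of the free energy.

A heat process conserves the energy, and its memory is restored; subadditivity and the minimality
of the free energy of the thermal environment show that the free energy of the system does not
increase. So its heat is a value of the optimal heat problem (`IsProcessHeat.mem_heatValues`).

All bounds concern the set of energies of states with free energy at most `y`
(`feasibleEnergies`). If `F_β(η) ≤ F_β(γ(x))`, the variational principle at `x` gives
`(β - x) (E(η) - E(γ(x))) ≤ 0`, so that `γ(x)` has the largest feasible energy when `x ≤ β` and the
smallest when `x ≥ β`; at `x = β` the equality case is needed. Two zeros of `f` lie on both sides of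
`β` unless all thermal states coincide (`gibbs_eq_or_mem_Icc`). Without a zero on one side of `β`
all thermal states of that side are feasible, and since `|x|` times the distance of `E(γ(x))` from
the end of the spectrum is at most `log d`, the whole spectrum is exhausted.

Extrema are attained because the states are the continuous image of the compact set of spectral
data, on which the entropy is visibly continuous, and because the convex hull of a compact set in
finite dimension is compact (`isCompact_convexHull_of_finiteDimensional`).
-/

namespace HeatWitness

open Matrix

/-! ### Spectral data and Klein's inequality -/

section Spectral

variable {a : Type*} [Fintype a] [DecidableEq a]

/-- The Hermitian matrix `U diag(d) Uᴴ` with spectral data `(U, d)`. -/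
noncomputable def conjDiag (U : Matrix a a ℂ) (d : a → ℝ) : Matrix a a ℂ :=
  U * diagonal (fun i => (d i : ℂ)) * Uᴴ

/-- The occupation `⟨v_j, A v_j⟩` of the `j`-th column `v_j` of `V`. -/
noncomputable def occupation (V A : Matrix a a ℂ) (j : a) : ℝ := ((Vᴴ * A * V) j j).re

lemma unitary_conjTranspose_mul {U : Matrix a a ℂ} (hU : U ∈ unitaryGroup a ℂ) : Uᴴ * U = 1 :=
  mem_unitaryGroup_iff'.1 hU

lemma unitary_mul_conjTranspose {U : Matrix a a ℂ} (hU : U ∈ unitaryGroup a ℂ) : U * Uᴴ = 1 :=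
  mem_unitaryGroup_iff.1 hU

lemma conjTranspose_mem_unitaryGroup {U : Matrix a a ℂ} (hU : U ∈ unitaryGroup a ℂ) :
    Uᴴ ∈ unitaryGroup a ℂ := Unitary.star_mem hU

lemma conjDiag_isHermitian (U : Matrix a a ℂ) (d : a → ℝ) : (conjDiag U d).IsHermitian := by
  unfold conjDiag
  apply isHermitian_mul_mul_conjTranspose
  rw [isHermitian_diagonal_iff]
  intro i
  simp [IsSelfAdjoint]

lemma exists_eq_conjDiag {A : Matrix a a ℂ} (hA : A.IsHermitian) :
    ∃ U ∈ unitaryGroup a ℂ, ∃ d : a → ℝ, A = conjDiag U d ∧ spectrum ℝ A = Set.range d := by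
  refine ⟨hA.eigenvectorUnitary, hA.eigenvectorUnitary.2, hA.eigenvalues, ?_,
    hA.spectrum_real_eq_range_eigenvalues⟩
  conv_lhs => rw [hA.spectral_theorem]
  rfl

lemma trace_conjDiag {U : Matrix a a ℂ} (hU : U ∈ unitaryGroup a ℂ) (d : a → ℝ) :
    (conjDiag U d).trace = ((∑ i, d i : ℝ) : ℂ) := by
  rw [conjDiag, trace_mul_comm, ← mul_assoc, unitary_conjTranspose_mul hU, one_mul]
  simp [trace_diagonal]

lemma conjDiag_mul {U : Matrix a a ℂ} (hU : U ∈ unitaryGroup a ℂ) (d e : a → ℝ) :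
    conjDiag U d * conjDiag U e = conjDiag U (fun i => d i * e i) := by
  unfold conjDiag
  calc _ = U * diagonal (fun i => (d i : ℂ)) * (Uᴴ * U) * diagonal (fun i => (e i : ℂ)) * Uᴴ := by
        simp only [mul_assoc]
    _ = _ := by
        rw [unitary_conjTranspose_mul hU, mul_one, mul_assoc U, diagonal_mul_diagonal]
        simp

lemma conjDiag_const {U : Matrix a a ℂ} (hU : U ∈ unitaryGroup a ℂ) (c : ℝ) :
    conjDiag U (fun _ => c) = c • (1 : Matrix a a ℂ) := by
  have : diagonal (fun _ : a => (c : ℂ)) = c • (1 : Matrix a a ℂ) := by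
    ext i j; simp [diagonal_apply, one_apply]
  rw [conjDiag, this]
  simp [unitary_mul_conjTranspose hU]

lemma conjDiag_add (U : Matrix a a ℂ) (d e : a → ℝ) :
    conjDiag U (d + e) = conjDiag U d + conjDiag U e := by
  unfold conjDiag
  rw [← add_mul, ← mul_add, diagonal_add]
  simp

lemma conjDiag_smul (U : Matrix a a ℂ) (c : ℝ) (d : a → ℝ) :
    conjDiag U (fun i => c * d i) = c • conjDiag U d := by
  unfold conjDiag
  have : diagonal (fun i : a => ((c * d i : ℝ) : ℂ)) = c • diagonal (fun i : a => (d i : ℂ)) := by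
    ext i j; by_cases h : i = j <;> simp [h]
  rw [this]; simp

lemma conjDiag_injective {U : Matrix a a ℂ} (hU : U ∈ unitaryGroup a ℂ) :
    Function.Injective (conjDiag U) := by
  intro d e h
  have key : ∀ d : a → ℝ, Uᴴ * conjDiag U d * U = diagonal (fun i => (d i : ℂ)) := fun d => by
    calc _ = (Uᴴ * U) * diagonal (fun i => (d i : ℂ)) * (Uᴴ * U) := by
          simp only [conjDiag, mul_assoc]
      _ = _ := by simp [unitary_conjTranspose_mul hU]
  have h2 := key e
  rw [← h, key d] at h2
  funext i
  simpa using congrFun (diagonal_injective h2) i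

lemma conjDiag_posSemidef (U : Matrix a a ℂ) {d : a → ℝ} (hd : ∀ i, 0 ≤ d i) :
    (conjDiag U d).PosSemidef := by
  unfold conjDiag
  apply PosSemidef.mul_mul_conjTranspose_same
  apply PosSemidef.diagonal
  intro i
  simpa using hd i

omit [DecidableEq a] in
lemma occupation_nonneg {A : Matrix a a ℂ} (hA : A.PosSemidef) (V : Matrix a a ℂ) (j : a) :
    0 ≤ occupation V A j :=
  (Complex.le_def.1 ((hA.conjTranspose_mul_mul_same V).diag_nonneg (i := j))).1

/-- The occupations of the eigenbasis of `conjDiag U d` are the numbers `d`. -/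
lemma occupation_conjDiag_self {U : Matrix a a ℂ} (hU : U ∈ unitaryGroup a ℂ) (d : a → ℝ) :
    occupation U (conjDiag U d) = d := by
  funext j
  have : Uᴴ * conjDiag U d * U = diagonal (fun i => (d i : ℂ)) := by
    calc _ = (Uᴴ * U) * diagonal (fun i => (d i : ℂ)) * (Uᴴ * U) := by
          simp only [conjDiag, mul_assoc]
      _ = _ := by simp [unitary_conjTranspose_mul hU]
  simp [occupation, this]

lemma eigenvalue_nonneg {U : Matrix a a ℂ} (hU : U ∈ unitaryGroup a ℂ) {d : a → ℝ}
    (h : (conjDiag U d).PosSemidef) (i : a) : 0 ≤ d i := by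
  have := occupation_nonneg h U i
  rwa [occupation_conjDiag_self hU] at this

lemma occupation_conjDiag (V U : Matrix a a ℂ) (d : a → ℝ) (j : a) :
    occupation V (conjDiag U d) j = ∑ i, Complex.normSq ((Uᴴ * V) i j) * d i := by
  have h1 : Vᴴ * conjDiag U d * V = (Uᴴ * V)ᴴ * (diagonal (fun i => (d i : ℂ)) * (Uᴴ * V)) := by
    simp only [conjDiag, conjTranspose_mul, conjTranspose_conjTranspose, mul_assoc]
  rw [occupation, h1, mul_apply, Complex.re_sum]
  refine Finset.sum_congr rfl fun i _ => ?_
  rw [diagonal_mul, conjTranspose_apply]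
  simp [Complex.normSq_apply]
  ring

lemma sum_occupation {V : Matrix a a ℂ} (hV : V ∈ unitaryGroup a ℂ) (A : Matrix a a ℂ) :
    ∑ j, occupation V A j = A.trace.re := by
  have : A.trace = (Vᴴ * A * V).trace := by
    rw [trace_mul_comm, ← mul_assoc, unitary_mul_conjTranspose hV, one_mul]
  rw [this, trace, Complex.re_sum]
  rfl

lemma trace_mul_conjDiag_re (V A : Matrix a a ℂ) (d : a → ℝ) :
    (A * conjDiag V d).trace.re = ∑ j, occupation V A j * d j := by
  have : (A * conjDiag V d).trace = (Vᴴ * A * V * diagonal (fun i => (d i : ℂ))).trace := by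
    rw [conjDiag, ← mul_assoc, trace_mul_comm]
    simp only [mul_assoc]
  rw [this, trace, Complex.re_sum]
  refine Finset.sum_congr rfl fun j _ => ?_
  rw [diag_apply, mul_diagonal]
  simp [occupation]

/-- The squared overlaps of two orthonormal bases form a doubly stochastic matrix. -/
lemma sum_normSq_row {W : Matrix a a ℂ} (hW : W ∈ unitaryGroup a ℂ) (i : a) :
    ∑ j, Complex.normSq (W i j) = 1 := by
  have h := congrFun (congrFun (unitary_mul_conjTranspose hW) i) i
  rw [mul_apply, one_apply_eq] at h
  have h2 := congrArg Complex.re h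
  rw [Complex.re_sum] at h2
  simpa [conjTranspose_apply, Complex.normSq_apply] using h2

lemma sum_normSq_col {W : Matrix a a ℂ} (hW : W ∈ unitaryGroup a ℂ) (j : a) :
    ∑ i, Complex.normSq (W i j) = 1 := by
  have h := sum_normSq_row (conjTranspose_mem_unitaryGroup hW) j
  simpa [conjTranspose_apply, Complex.normSq_apply] using h

lemma aeval_conjDiag {U : Matrix a a ℂ} (hU : U ∈ unitaryGroup a ℂ) (d : a → ℝ)
    (p : Polynomial ℝ) :
    Polynomial.aeval (conjDiag U d) p = conjDiag U (fun i => p.eval (d i)) := by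
  induction p using Polynomial.induction_on with
  | C c =>
    simp only [Polynomial.aeval_C, Polynomial.eval_C, conjDiag_const hU, Algebra.algebraMap_eq_smul_one]
  | add p q hp hq =>
    rw [map_add, hp, hq, ← conjDiag_add]
    congr 1; funext i; simp
  | monomial n c h =>
    rw [pow_succ, ← mul_assoc, map_mul, h, Polynomial.aeval_X, conjDiag_mul hU]
    congr 1; funext i; simp [mul_assoc]

/-- Functional calculus may be computed in any eigenbasis. -/
lemma cfc_conjDiag {U : Matrix a a ℂ} (hU : U ∈ unitaryGroup a ℂ) (d : a → ℝ) (f : ℝ → ℝ) :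
    cfc f (conjDiag U d) = conjDiag U (fun i => f (d i)) := by
  have hA := conjDiag_isHermitian U d
  -- on the finite set of eigenvalues, `f` agrees with a polynomial
  let S : Finset ℝ := Finset.univ.image d ∪ (Matrix.finite_real_spectrum (A := conjDiag U d)).toFinset
  let p : Polynomial ℝ := Lagrange.interpolate S id f
  have hp : ∀ x ∈ S, p.eval x = f x := fun x hx =>
    Lagrange.eval_interpolate_at_node (v := id) f (Function.injective_id.injOn) hx
  have h1 : cfc f (conjDiag U d) = cfc p.eval (conjDiag U d) := by
    apply cfc_congr
    intro x hx
    exact (hp x (by simp only [S, Finset.mem_union]; right; simpa using hx)).symm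
  rw [h1, cfc_polynomial p _ hA.isSelfAdjoint, aeval_conjDiag hU]
  congr 1; funext i
  exact hp _ (by simp [S])

lemma entropy_conjDiag {U : Matrix a a ℂ} (hU : U ∈ unitaryGroup a ℂ) (d : a → ℝ) :
    entropy (conjDiag U d) = ∑ i, Real.negMulLog (d i) := by
  rw [entropy, cfc_conjDiag hU, conjDiag_mul hU, trace_conjDiag hU, Complex.ofReal_re,
    ← Finset.sum_neg_distrib]
  exact Finset.sum_congr rfl fun i _ => by simp [Real.negMulLog]

omit [DecidableEq a] in
lemma IsState.isHermitian {ρ : Matrix a a ℂ} (h : IsState ρ) : ρ.IsHermitian := h.1.isHermitian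

/-- A state has a spectral decomposition whose eigenvalues form a probability vector. -/
lemma IsState.exists_eq_conjDiag {ρ : Matrix a a ℂ} (h : IsState ρ) :
    ∃ U ∈ unitaryGroup a ℂ, ∃ p : a → ℝ, ρ = conjDiag U p ∧ (∀ i, 0 ≤ p i) ∧ ∑ i, p i = 1 := by
  obtain ⟨U, hU, p, rfl, -⟩ := HeatWitness.exists_eq_conjDiag h.isHermitian
  refine ⟨U, hU, p, rfl, eigenvalue_nonneg hU h.1, ?_⟩
  have := h.2
  rw [trace_conjDiag hU] at this
  exact_mod_cast this

lemma isState_conjDiag {U : Matrix a a ℂ} (hU : U ∈ unitaryGroup a ℂ) {p : a → ℝ}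
    (hp : ∀ i, 0 ≤ p i) (h1 : ∑ i, p i = 1) : IsState (conjDiag U p) :=
  ⟨conjDiag_posSemidef U hp, by rw [trace_conjDiag hU, h1]; simp⟩

end Spectral

section Klein

variable {a : Type*} [Fintype a] [DecidableEq a]

/-- Klein's inequality for numbers, the estimate `log x ≤ x - 1` at `x = q / p`. -/
lemma klein_scalar {p q : ℝ} (hp : 0 ≤ p) (hq : 0 < q) :
    Real.negMulLog p ≤ -(p * Real.log q) + q - p ∧
      (Real.negMulLog p = -(p * Real.log q) + q - p → p = q) := by
  rcases hp.eq_or_lt with rfl | hp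
  · simp only [Real.negMulLog_zero, zero_mul, neg_zero, zero_add, sub_zero]
    exact ⟨hq.le, fun h => h⟩
  have hdiv : 0 < q / p := div_pos hq hp
  have hlog : Real.log (q / p) = Real.log q - Real.log p := Real.log_div hq.ne' hp.ne'
  have hqp : p * (q / p) = q := by field_simp
  constructor
  · have := mul_le_mul_of_nonneg_left (Real.log_le_sub_one_of_pos hdiv) hp.le
    rw [hlog, mul_sub, mul_sub, hqp] at this
    unfold Real.negMulLog; linarith
  · intro h
    by_contra hne
    have h1 : q / p ≠ 1 := by
      intro h1; rw [div_eq_one_iff_eq hp.ne'] at h1; exact hne h1.symm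
    have := mul_lt_mul_of_pos_left (Real.log_lt_sub_one_of_pos hdiv h1) hp
    rw [hlog, mul_sub, mul_sub, hqp] at this
    unfold Real.negMulLog at h; linarith

/-- **Klein's inequality** `S(ρ) ≤ -tr[ρ log σ] + tr σ - 1` for a positive operator `σ` with
eigenbasis `V` and eigenvalues `q`, whose kernel is contained in that of the state `ρ`, with its
equality case `ρ = σ`. -/
lemma klein {ρ V : Matrix a a ℂ} (hρ : IsState ρ) (hV : V ∈ unitaryGroup a ℂ) {q : a → ℝ}
    (hq : ∀ j, 0 ≤ q j) (hsupp : ∀ j, q j = 0 → occupation V ρ j = 0) :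
    entropy ρ ≤ -∑ j, occupation V ρ j * Real.log (q j) + ∑ j, q j - 1 ∧
      (entropy ρ = -∑ j, occupation V ρ j * Real.log (q j) + ∑ j, q j - 1 →
        ρ = conjDiag V q) := by
  obtain ⟨U, hU, p, rfl, hp, hp1⟩ := hρ.exists_eq_conjDiag
  set W := Uᴴ * V with hW
  have hWu : W ∈ unitaryGroup a ℂ := mul_mem (conjTranspose_mem_unitaryGroup hU) hV
  have hocc : ∀ j, occupation V (conjDiag U p) j = ∑ i, Complex.normSq (W i j) * p i :=
    occupation_conjDiag V U p
  let L : a → a → ℝ := fun i j => Complex.normSq (W i j) * Real.negMulLog (p i)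
  let R : a → a → ℝ := fun i j =>
    Complex.normSq (W i j) * (-(p i * Real.log (q j)) + q j - p i)
  have hLR : ∀ i j, L i j ≤ R i j ∧ (L i j = R i j → W i j * (q j : ℂ) = (p i : ℂ) * W i j) := by
    intro i j
    rcases (hq j).eq_or_lt with h0 | hpos
    · have h1 := hsupp j h0.symm
      rw [hocc, Finset.sum_eq_zero_iff_of_nonneg
        (fun i _ => mul_nonneg (Complex.normSq_nonneg _) (hp i))] at h1
      rcases mul_eq_zero.1 (h1 i (Finset.mem_univ i)) with h2 | h2
      · have h3 : W i j = 0 := Complex.normSq_eq_zero.1 h2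
        simp [L, R, h3]
      · simp [L, R, h2, ← h0]
    · have hs := klein_scalar (hp i) hpos
      refine ⟨mul_le_mul_of_nonneg_left hs.1 (Complex.normSq_nonneg _), fun h => ?_⟩
      rcases mul_eq_mul_left_iff.1 h with h2 | h2
      · rw [hs.2 h2, mul_comm]
      · simp [Complex.normSq_eq_zero.1 h2]
  have hL : entropy (conjDiag U p) = ∑ i, ∑ j, L i j := by
    rw [entropy_conjDiag hU]
    refine Finset.sum_congr rfl fun i _ => ?_
    rw [← Finset.sum_mul, sum_normSq_row hWu, one_mul]
  have hR : -∑ j, occupation V (conjDiag U p) j * Real.log (q j) + ∑ j, q j - 1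
      = ∑ i, ∑ j, R i j := by
    have e1 : ∑ j, q j = ∑ j, ∑ i, Complex.normSq (W i j) * q j :=
      Finset.sum_congr rfl fun j _ => by rw [← Finset.sum_mul, sum_normSq_col hWu, one_mul]
    have e2 : (1 : ℝ) = ∑ j, ∑ i, Complex.normSq (W i j) * p i := by
      rw [Finset.sum_comm, ← hp1]
      exact Finset.sum_congr rfl fun i _ => by rw [← Finset.sum_mul, sum_normSq_row hWu, one_mul]
    rw [e1, e2, Finset.sum_comm (f := R), ← Finset.sum_neg_distrib, ← Finset.sum_add_distrib,
      ← Finset.sum_sub_distrib]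
    refine Finset.sum_congr rfl fun j _ => ?_
    rw [hocc, Finset.sum_mul, ← Finset.sum_neg_distrib, ← Finset.sum_add_distrib,
      ← Finset.sum_sub_distrib]
    refine Finset.sum_congr rfl fun i _ => ?_
    simp only [R]; ring
  rw [hL, hR]
  refine ⟨Finset.sum_le_sum fun i _ => Finset.sum_le_sum fun j _ => (hLR i j).1, fun h => ?_⟩
  have h1 := (Finset.sum_eq_sum_iff_of_le
    (fun i _ => Finset.sum_le_sum fun j _ => (hLR i j).1)).1 h
  -- in the equality case the overlap matrix intertwines the two diagonal matrices
  have h2 : W * diagonal (fun j => (q j : ℂ)) = diagonal (fun i => (p i : ℂ)) * W := by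
    ext i j
    rw [mul_diagonal, diagonal_mul]
    exact (hLR i j).2 ((Finset.sum_eq_sum_iff_of_le (fun j _ => (hLR i j).1)).1
      (h1 i (Finset.mem_univ i)) j (Finset.mem_univ j))
  calc conjDiag U p = U * (diagonal (fun i => (p i : ℂ)) * W) * Vᴴ := by
        rw [hW, conjDiag]
        simp only [mul_assoc, unitary_mul_conjTranspose hV, mul_one]
    _ = conjDiag V q := by
        rw [← h2, hW, conjDiag, ← mul_assoc, ← mul_assoc, unitary_mul_conjTranspose hU, one_mul]

/-- A consequence of the operator monotonicity of the logarithm: if `ρ ≤ σ`, where `σ` has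
eigenbasis `V` and eigenvalues `q`, then `S(ρ) ≥ -tr[ρ log σ]`. -/
lemma entropy_ge_of_le {ρ V : Matrix a a ℂ} (hρ : ρ.PosSemidef) (hV : V ∈ unitaryGroup a ℂ)
    {q : a → ℝ} (hle : (conjDiag V q - ρ).PosSemidef) :
    -∑ j, occupation V ρ j * Real.log (q j) ≤ entropy ρ := by
  obtain ⟨U, hU, p, rfl, -⟩ := HeatWitness.exists_eq_conjDiag hρ.isHermitian
  have hp := eigenvalue_nonneg hU hρ
  set W := Uᴴ * V with hW
  have hWu : W ∈ unitaryGroup a ℂ := mul_mem (conjTranspose_mem_unitaryGroup hU) hV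
  have hocc : ∀ j, occupation V (conjDiag U p) j = ∑ i, Complex.normSq (W i j) * p i :=
    occupation_conjDiag V U p
  have hocc_le : ∀ j, occupation V (conjDiag U p) j ≤ q j := by
    intro j
    have h1 := occupation_nonneg hle V j
    have h2 := congrFun (occupation_conjDiag_self hV q) j
    unfold occupation at h1 h2 ⊢
    rw [mul_sub, sub_mul, Matrix.sub_apply, Complex.sub_re] at h1
    linarith
  have hterm : ∀ i j, Complex.normSq (W i j) * p i ≤ occupation V (conjDiag U p) j := fun i j => by
    rw [hocc]
    exact Finset.single_le_sum (f := fun i => Complex.normSq (W i j) * p i)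
      (fun i _ => mul_nonneg (Complex.normSq_nonneg _) (hp i)) (Finset.mem_univ i)
  have hq : ∀ j, 0 ≤ q j := fun j => (occupation_nonneg hρ V j).trans (hocc_le j)
  -- the quadratic form of `ρ ≤ σ` at `σ⁻¹ u`, for an eigenvector `u` of `ρ`
  have hkey : ∀ i, ∑ j, Complex.normSq (W i j) * p i * (q j)⁻¹ ≤ 1 := by
    intro i
    set T := conjDiag W (fun j => (q j)⁻¹) with hT
    have hTh : Tᴴ = T := (conjDiag_isHermitian W _).eq
    have hpsd : (T - T * diagonal (fun i => (p i : ℂ)) * Tᴴ).PosSemidef := by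
      have h1 := (hle.conjTranspose_mul_mul_same U).mul_mul_conjTranspose_same T
      have h2 : Uᴴ * (conjDiag V q - conjDiag U p) * U =
          conjDiag W q - diagonal (fun i => (p i : ℂ)) := by
        rw [mul_sub, sub_mul]
        congr 1
        · simp only [hW, conjDiag, conjTranspose_mul, conjTranspose_conjTranspose, mul_assoc]
        · calc _ = (Uᴴ * U) * diagonal (fun i => (p i : ℂ)) * (Uᴴ * U) := by
                simp only [conjDiag, mul_assoc]
            _ = _ := by simp [unitary_conjTranspose_mul hU]
      have h3 : T * conjDiag W q * Tᴴ = T := by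
        rw [hTh, hT, conjDiag_mul hWu, conjDiag_mul hWu]
        congr 1; funext j
        -- this also holds at a zero eigenvalue of `σ`, whose inverse is zero by convention
        by_cases h0 : q j = 0
        · simp [h0]
        · field_simp
      rwa [h2, mul_sub, sub_mul, h3] at h1
    have hTii : T i i = ((∑ j, Complex.normSq (W i j) * (q j)⁻¹ : ℝ) : ℂ) := by
      rw [hT, conjDiag, mul_apply, Complex.ofReal_sum]
      refine Finset.sum_congr rfl fun j _ => ?_
      rw [mul_diagonal, conjTranspose_apply, Complex.ofReal_mul, Complex.normSq_eq_conj_mul_self,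
        Complex.star_def]
      ring
    set t := ∑ j, Complex.normSq (W i j) * (q j)⁻¹ with ht
    have ht0 : 0 ≤ t := Finset.sum_nonneg fun j _ =>
      mul_nonneg (Complex.normSq_nonneg _) (inv_nonneg.2 (hq j))
    have hle2 : p i * t ^ 2 ≤ t := by
      have h1 := (Complex.le_def.1 (hpsd.diag_nonneg (i := i))).1
      have h2 : ((T * diagonal (fun i => (p i : ℂ)) * Tᴴ) i i).re =
          ∑ k, p k * Complex.normSq (T i k) := by
        rw [mul_apply, Complex.re_sum]
        refine Finset.sum_congr rfl fun k _ => ?_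
        rw [mul_diagonal, conjTranspose_apply]
        simp [Complex.normSq_apply]; ring
      have h3 : p i * Complex.normSq (T i i) ≤ ∑ k, p k * Complex.normSq (T i k) :=
        Finset.single_le_sum (f := fun k => p k * Complex.normSq (T i k))
          (fun k _ => mul_nonneg (hp k) (Complex.normSq_nonneg _)) (Finset.mem_univ i)
      rw [Matrix.sub_apply, Complex.sub_re, h2] at h1
      rw [hTii, Complex.normSq_ofReal, ← sq] at h3
      rw [hTii, Complex.ofReal_re] at h1
      simp only [Complex.zero_re] at h1
      linarith
    have e : ∑ j, Complex.normSq (W i j) * p i * (q j)⁻¹ = p i * t := by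
      rw [ht, Finset.mul_sum]
      exact Finset.sum_congr rfl fun j _ => by ring
    rw [e]
    rcases ht0.eq_or_lt with h0 | hpos
    · rw [← h0]; simp
    · refine le_of_mul_le_mul_right ?_ hpos
      linarith [sq t]
  rw [entropy_conjDiag hU, ← sub_nonneg, sub_neg_eq_add]
  have e1 : ∑ i, Real.negMulLog (p i) = ∑ i, ∑ j, Complex.normSq (W i j) * Real.negMulLog (p i) :=
    Finset.sum_congr rfl fun i _ => by rw [← Finset.sum_mul, sum_normSq_row hWu, one_mul]
  have e2 : ∑ j, occupation V (conjDiag U p) j * Real.log (q j) =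
      ∑ i, ∑ j, Complex.normSq (W i j) * p i * Real.log (q j) := by
    rw [Finset.sum_comm]
    exact Finset.sum_congr rfl fun j _ => by rw [hocc, Finset.sum_mul]
  rw [e1, e2, ← Finset.sum_add_distrib]
  refine Finset.sum_nonneg fun i _ => ?_
  rw [← Finset.sum_add_distrib]
  have h3 : p i - p i * ∑ j, Complex.normSq (W i j) * p i * (q j)⁻¹ ≤
      ∑ j, (Complex.normSq (W i j) * Real.negMulLog (p i) +
        Complex.normSq (W i j) * p i * Real.log (q j)) := by
    have e3 : p i = ∑ j, Complex.normSq (W i j) * p i := by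
      rw [← Finset.sum_mul, sum_normSq_row hWu, one_mul]
    conv_lhs => enter [1]; rw [e3]
    rw [Finset.mul_sum, ← Finset.sum_sub_distrib]
    refine Finset.sum_le_sum fun j _ => ?_
    set w := Complex.normSq (W i j) with hw
    have hw0 : 0 ≤ w := Complex.normSq_nonneg _
    rcases (mul_nonneg hw0 (hp i)).eq_or_lt with h0 | hpos
    · rcases mul_eq_zero.1 h0.symm with h | h
      · simp [h]
      · simp [h]
    · have hqj : 0 < q j := hpos.trans_le ((hterm i j).trans (hocc_le j))
      have hpi : 0 < p i := lt_of_le_of_ne (hp i) fun h => by simp [← h] at hpos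
      have := Real.log_le_sub_one_of_pos (div_pos hpi hqj)
      rw [Real.log_div hpi.ne' hqj.ne'] at this
      have h4 := mul_le_mul_of_nonneg_left this hpos.le
      unfold Real.negMulLog
      have h5 : w * p i * (p i / q j - 1) = p i * (w * p i * (q j)⁻¹) - w * p i := by
        rw [div_eq_mul_inv]; ring
      rw [h5] at h4
      linarith
  have h4 := mul_le_mul_of_nonneg_left (hkey i) (hp i)
  linarith

end Klein

/-! ### Thermal states -/

section Thermal

variable {a : Type*} [Fintype a]

/-- The partition function `∑ⱼ exp(-x ε_j)`. -/
noncomputable def partitionFunction (x : ℝ) (ε : a → ℝ) : ℝ := ∑ j, Real.exp (-x * ε j)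

/-- The Boltzmann weights `exp(-x ε_j) / Z`. -/
noncomputable def boltzmann (x : ℝ) (ε : a → ℝ) (j : a) : ℝ :=
  (partitionFunction x ε)⁻¹ * Real.exp (-x * ε j)

lemma partitionFunction_pos [Nonempty a] (x : ℝ) (ε : a → ℝ) : 0 < partitionFunction x ε :=
  Finset.sum_pos (fun _ _ => Real.exp_pos _) Finset.univ_nonempty

lemma boltzmann_pos [Nonempty a] (x : ℝ) (ε : a → ℝ) (j : a) : 0 < boltzmann x ε j :=
  mul_pos (inv_pos.2 (partitionFunction_pos x ε)) (Real.exp_pos _)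

lemma sum_boltzmann [Nonempty a] (x : ℝ) (ε : a → ℝ) : ∑ j, boltzmann x ε j = 1 := by
  simp only [boltzmann, ← Finset.mul_sum]
  exact inv_mul_cancel₀ (partitionFunction_pos x ε).ne'

lemma log_boltzmann [Nonempty a] (x : ℝ) (ε : a → ℝ) (j : a) :
    Real.log (boltzmann x ε j) = -x * ε j - Real.log (partitionFunction x ε) := by
  rw [boltzmann, Real.log_mul (inv_pos.2 (partitionFunction_pos x ε)).ne' (Real.exp_pos _).ne',
    Real.log_inv, Real.log_exp]
  ring

/-- Boltzmann weights at two different temperatures agree only for a constant energy, in which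
case they do not depend on the temperature at all. -/
lemma boltzmann_eq_of_eq [Nonempty a] {x₁ x₂ : ℝ} (hx : x₁ ≠ x₂) {ε : a → ℝ}
    (h : boltzmann x₁ ε = boltzmann x₂ ε) (y : ℝ) : boltzmann y ε = boltzmann x₁ ε := by
  have hc : ∀ j, ε j =
      (Real.log (partitionFunction x₁ ε) - Real.log (partitionFunction x₂ ε)) / (x₂ - x₁) := by
    intro j
    have h1 := congrArg Real.log (congrFun h j)
    rw [log_boltzmann, log_boltzmann] at h1
    rw [eq_div_iff (sub_ne_zero.2 hx.symm)]
    linarith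
  generalize (Real.log (partitionFunction x₁ ε) - Real.log (partitionFunction x₂ ε)) / (x₂ - x₁) = c
    at hc
  obtain rfl : ε = fun _ => c := funext hc
  funext j
  have hcard : (Fintype.card a : ℝ) ≠ 0 := Nat.cast_ne_zero.2 Fintype.card_ne_zero
  simp only [boltzmann, partitionFunction, Finset.sum_const, Finset.card_univ, nsmul_eq_mul]
  field_simp

variable [DecidableEq a]

lemma exp_conjDiag {V : Matrix a a ℂ} (hV : V ∈ unitaryGroup a ℂ) (d : a → ℝ) :
    NormedSpace.exp (conjDiag V d) = conjDiag V (fun j => Real.exp (d j)) := by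
  have hinv : V⁻¹ = Vᴴ := inv_eq_left_inv (unitary_conjTranspose_mul hV)
  have hu : IsUnit V := IsUnit.of_mul_eq_one _ (unitary_mul_conjTranspose hV)
  unfold conjDiag
  rw [← hinv, exp_conj V _ hu, exp_diagonal]
  congr 3
  funext j
  rw [Pi.coe_exp, ← Complex.exp_eq_exp_ℂ, Complex.ofReal_exp]

lemma gibbs_conjDiag {V : Matrix a a ℂ} (hV : V ∈ unitaryGroup a ℂ) (x : ℝ) (ε : a → ℝ) :
    gibbs x (conjDiag V ε) = conjDiag V (boltzmann x ε) := by
  rw [gibbs, ← conjDiag_smul, exp_conjDiag hV, trace_conjDiag hV, ← Complex.ofReal_inv]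
  unfold boltzmann
  rw [conjDiag_smul, partitionFunction]
  ext i j
  simp

lemma isState_gibbs [Nonempty a] {H : Matrix a a ℂ} (hH : H.IsHermitian) (x : ℝ) :
    IsState (gibbs x H) := by
  obtain ⟨V, hV, ε, rfl, -⟩ := HeatWitness.exists_eq_conjDiag hH
  rw [gibbs_conjDiag hV]
  exact isState_conjDiag hV (fun j => (boltzmann_pos x ε j).le) (sum_boltzmann x ε)

lemma energy_conjDiag (V ρ : Matrix a a ℂ) (ε : a → ℝ) :
    energy (conjDiag V ε) ρ = ∑ j, occupation V ρ j * ε j := by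
  rw [energy, trace_mul_comm, trace_mul_conjDiag_re]

/-- The Gibbs variational principle with its equality case, for spectral data of the
Hamiltonian. -/
lemma entropy_le_energy_add_log [Nonempty a] {V ρ : Matrix a a ℂ} (hV : V ∈ unitaryGroup a ℂ)
    (ε : a → ℝ) (hρ : IsState ρ) (x : ℝ) :
    entropy ρ ≤ x * energy (conjDiag V ε) ρ + Real.log (partitionFunction x ε) ∧
      (entropy ρ = x * energy (conjDiag V ε) ρ + Real.log (partitionFunction x ε) →
        ρ = gibbs x (conjDiag V ε)) := by
  have h := klein hρ hV (q := boltzmann x ε) (fun j => (boltzmann_pos x ε j).le)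
    (fun j hj => absurd hj (boltzmann_pos x ε j).ne')
  have hsum : ∑ j, occupation V ρ j = 1 := by rw [sum_occupation hV, hρ.2]; simp
  have e : -∑ j, occupation V ρ j * Real.log (boltzmann x ε j) + ∑ j, boltzmann x ε j - 1 =
      x * energy (conjDiag V ε) ρ + Real.log (partitionFunction x ε) := by
    rw [sum_boltzmann, energy_conjDiag]
    simp only [log_boltzmann, mul_sub, Finset.sum_sub_distrib, ← Finset.sum_mul, hsum]
    rw [Finset.mul_sum, one_mul, neg_sub, add_sub_cancel_right, sub_eq_add_neg, add_comm,
      ← Finset.sum_neg_distrib]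
    congr 1
    exact Finset.sum_congr rfl fun j _ => by ring
  rw [e] at h
  rwa [gibbs_conjDiag hV]

lemma energy_gibbs_conjDiag {V : Matrix a a ℂ} (hV : V ∈ unitaryGroup a ℂ) (ε : a → ℝ) (x : ℝ) :
    energy (conjDiag V ε) (gibbs x (conjDiag V ε)) = ∑ j, boltzmann x ε j * ε j := by
  rw [gibbs_conjDiag hV, energy_conjDiag, occupation_conjDiag_self hV]

lemma entropy_gibbs_conjDiag [Nonempty a] {V : Matrix a a ℂ} (hV : V ∈ unitaryGroup a ℂ)
    (ε : a → ℝ) (x : ℝ) :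
    entropy (gibbs x (conjDiag V ε)) =
      x * energy (conjDiag V ε) (gibbs x (conjDiag V ε)) + Real.log (partitionFunction x ε) := by
  rw [energy_gibbs_conjDiag hV, gibbs_conjDiag hV, entropy_conjDiag hV, Finset.mul_sum]
  conv_rhs => rw [← one_mul (Real.log _), ← sum_boltzmann x ε, Finset.sum_mul]
  rw [← Finset.sum_add_distrib]
  refine Finset.sum_congr rfl fun j _ => ?_
  rw [Real.negMulLog, log_boltzmann]; ring

/-- The Gibbs variational principle: the thermal state is the unique maximizer of
`S(η) - x E(η)`. -/
lemma entropy_le_gibbs [Nonempty a] {H η : Matrix a a ℂ} (hH : H.IsHermitian) (hη : IsState η)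
    (x : ℝ) :
    entropy η ≤ entropy (gibbs x H) + x * (energy H η - energy H (gibbs x H)) ∧
      (entropy η = entropy (gibbs x H) + x * (energy H η - energy H (gibbs x H)) →
        η = gibbs x H) := by
  obtain ⟨V, hV, ε, rfl, -⟩ := HeatWitness.exists_eq_conjDiag hH
  have h := entropy_le_energy_add_log hV ε hη x
  have e := entropy_gibbs_conjDiag hV ε x
  have e2 : entropy (gibbs x (conjDiag V ε)) +
      x * (energy (conjDiag V ε) η - energy (conjDiag V ε) (gibbs x (conjDiag V ε))) =
      x * energy (conjDiag V ε) η + Real.log (partitionFunction x ε) := by rw [e]; ring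
  rwa [e2]

lemma entropy_le_log_card [Nonempty a] {ρ : Matrix a a ℂ} (hρ : IsState ρ) :
    entropy ρ ≤ Real.log (Fintype.card a) := by
  have h := (entropy_le_energy_add_log (one_mem (unitaryGroup a ℂ)) (fun _ => 0) hρ 0).1
  simpa [partitionFunction] using h

variable {H : Matrix a a ℂ} {β : ℝ}

/-- The thermal state at the inverse temperature of the environment minimizes the free energy. -/
lemma freeEnergy_gibbs_le [Nonempty a] (hH : H.IsHermitian) (hβ : 0 < β) {η : Matrix a a ℂ}
    (hη : IsState η) : freeEnergy β H (gibbs β H) ≤ freeEnergy β H η := by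
  have h := (entropy_le_gibbs hH hη β).1
  unfold freeEnergy
  have h2 : (entropy η - entropy (gibbs β H)) / β ≤ energy H η - energy H (gibbs β H) := by
    rw [div_le_iff₀ hβ]; linarith
  rw [sub_div] at h2
  linarith

/-- A state whose free energy is at most that of `γ(x)` has an energy on a definite side of that
of `γ(x)`, depending on the sign of `β - x`. At `x = β` the two states coincide. -/
lemma mul_energy_sub_le [Nonempty a] (hH : H.IsHermitian) (hβ : 0 < β) {x : ℝ} {η : Matrix a a ℂ}
    (hη : IsState η) (hle : freeEnergy β H η ≤ freeEnergy β H (gibbs x H)) :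
    (β - x) * (energy H η - energy H (gibbs x H)) ≤ 0 ∧
      (x = β → energy H η = energy H (gibbs x H)) := by
  have h := entropy_le_gibbs hH hη x
  unfold freeEnergy at hle
  have h2 : energy H η - energy H (gibbs x H) ≤ (entropy η - entropy (gibbs x H)) / β := by
    rw [sub_div]; linarith
  rw [le_div_iff₀ hβ] at h2
  refine ⟨by linarith [h.1], fun hx => ?_⟩
  subst hx
  rw [← h.2 (by linarith [h.1])]

lemma energy_le_energy_gibbs [Nonempty a] (hH : H.IsHermitian) (hβ : 0 < β) {x : ℝ} (hx : x ≤ β)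
    {η : Matrix a a ℂ} (hη : IsState η)
    (hle : freeEnergy β H η ≤ freeEnergy β H (gibbs x H)) :
    energy H η ≤ energy H (gibbs x H) := by
  have h := mul_energy_sub_le hH hβ hη hle
  rcases hx.eq_or_lt with hx | hx
  · exact (h.2 hx).le
  · nlinarith [h.1, sub_pos.2 hx]

lemma energy_gibbs_le_energy [Nonempty a] (hH : H.IsHermitian) (hβ : 0 < β) {x : ℝ} (hx : β ≤ x)
    {η : Matrix a a ℂ} (hη : IsState η)
    (hle : freeEnergy β H η ≤ freeEnergy β H (gibbs x H)) :
    energy H (gibbs x H) ≤ energy H η := by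
  have h := mul_energy_sub_le hH hβ hη hle
  rcases hx.eq_or_lt with hx | hx
  · exact (h.2 hx.symm).ge
  · nlinarith [h.1, sub_pos.2 hx]

/-- Two thermal states with equal free energy lie on both sides of `β`, unless the Hamiltonian is
a multiple of the identity, in which case all thermal states coincide. -/
lemma gibbs_eq_or_mem_Icc [Nonempty a] (hH : H.IsHermitian) (hβ : 0 < β) {x₁ x₂ : ℝ}
    (hx : x₁ < x₂) (he : freeEnergy β H (gibbs x₁ H) = freeEnergy β H (gibbs x₂ H)) :
    (∀ y, gibbs y H = gibbs x₁ H) ∨ (x₁ ≤ β ∧ β ≤ x₂) := by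
  by_cases hβx : x₁ ≤ β ∧ β ≤ x₂
  · exact Or.inr hβx
  left
  have h1 := isState_gibbs hH x₁
  have h2 := isState_gibbs hH x₂
  have hE : energy H (gibbs x₁ H) = energy H (gibbs x₂ H) := by
    rcases not_and_or.1 hβx with h | h
    · rw [not_le] at h
      exact le_antisymm (energy_gibbs_le_energy hH hβ h.le h2 he.ge)
        (energy_gibbs_le_energy hH hβ (h.trans hx).le h1 he.le)
    · rw [not_le] at h
      exact le_antisymm (energy_le_energy_gibbs hH hβ h.le h1 he.le)
        (energy_le_energy_gibbs hH hβ (hx.trans h).le h2 he.ge)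
  have hS : entropy (gibbs x₂ H) = entropy (gibbs x₁ H) := by
    unfold freeEnergy at he
    rw [hE, sub_right_inj, div_left_inj' hβ.ne'] at he
    exact he.symm
  have heq : gibbs x₂ H = gibbs x₁ H := (entropy_le_gibbs hH h2 x₁).2 (by rw [hS, hE]; ring)
  obtain ⟨V, hV, ε, rfl, -⟩ := HeatWitness.exists_eq_conjDiag hH
  simp only [gibbs_conjDiag hV] at heq ⊢
  have := conjDiag_injective hV heq
  exact fun y => by rw [boltzmann_eq_of_eq hx.ne this.symm y]

lemma continuous_freeEnergy_gibbs [Nonempty a] (hH : H.IsHermitian) (β : ℝ) :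
    Continuous fun x => freeEnergy β H (gibbs x H) := by
  obtain ⟨V, hV, ε, rfl, -⟩ := HeatWitness.exists_eq_conjDiag hH
  simp only [freeEnergy, entropy_gibbs_conjDiag hV, energy_gibbs_conjDiag hV]
  have hZ : Continuous fun x => partitionFunction x ε := by unfold partitionFunction; fun_prop
  have hB : ∀ j, Continuous fun x => boltzmann x ε j := fun j => by
    unfold boltzmann
    exact (hZ.inv₀ fun x => (partitionFunction_pos x ε).ne').mul (by fun_prop)
  have hE : Continuous fun x => ∑ j, boltzmann x ε j * ε j := by fun_prop
  have hL := hZ.log fun x => (partitionFunction_pos x ε).ne'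
  fun_prop

lemma energy_mem_Icc {V : Matrix a a ℂ} (hV : V ∈ unitaryGroup a ℂ) {ε : a → ℝ} {l u : ℝ}
    (hl : ∀ j, l ≤ ε j) (hu : ∀ j, ε j ≤ u) {η : Matrix a a ℂ} (hη : IsState η) :
    energy (conjDiag V ε) η ∈ Set.Icc l u := by
  have hsum : ∑ j, occupation V η j = 1 := by rw [sum_occupation hV, hη.2]; simp
  rw [energy_conjDiag]
  constructor
  · rw [← one_mul l, ← hsum, Finset.sum_mul]
    exact Finset.sum_le_sum fun j _ =>
      mul_le_mul_of_nonneg_left (hl j) (occupation_nonneg hη.1 V j)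
  · rw [← one_mul u, ← hsum, Finset.sum_mul]
    exact Finset.sum_le_sum fun j _ =>
      mul_le_mul_of_nonneg_left (hu j) (occupation_nonneg hη.1 V j)

/-- `x E(γ(x)) ≤ x ε + log d` for every eigenvalue `ε`: at low temperatures of either sign the
energy of the thermal state is close to an end of the spectrum. -/
lemma mul_energy_gibbs_le [Nonempty a] {V : Matrix a a ℂ} (hV : V ∈ unitaryGroup a ℂ)
    (ε : a → ℝ) (x : ℝ) (j : a) :
    x * energy (conjDiag V ε) (gibbs x (conjDiag V ε)) ≤ x * ε j + Real.log (Fintype.card a) := by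
  have h1 := entropy_le_log_card (isState_gibbs (conjDiag_isHermitian V ε) x)
  rw [entropy_gibbs_conjDiag hV] at h1
  have h2 : -x * ε j ≤ Real.log (partitionFunction x ε) := by
    rw [Real.le_log_iff_exp_le (partitionFunction_pos x ε)]
    exact Finset.single_le_sum (f := fun j => Real.exp (-x * ε j))
      (fun j _ => (Real.exp_pos _).le) (Finset.mem_univ j)
  linarith

/-- The energies of the states of free energy at most `y`. -/
def feasibleEnergies (β : ℝ) (H : Matrix a a ℂ) (y : ℝ) : Set ℝ :=
  {e | ∃ η, IsState η ∧ freeEnergy β H η ≤ y ∧ e = energy H η}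

lemma isGreatest_feasibleEnergies [Nonempty a] (hH : H.IsHermitian) (hβ : 0 < β) {x y : ℝ}
    (hx : x ≤ β) (h0 : thermalGap β H x y = 0) :
    IsGreatest (feasibleEnergies β H y) (energy H (gibbs x H)) := by
  have hy : y = freeEnergy β H (gibbs x H) := sub_eq_zero.1 h0
  refine ⟨⟨_, isState_gibbs hH x, hy.ge, rfl⟩, ?_⟩
  rintro _ ⟨η, hη, hle, rfl⟩
  exact energy_le_energy_gibbs hH hβ hx hη (hy ▸ hle)

lemma isLeast_feasibleEnergies [Nonempty a] (hH : H.IsHermitian) (hβ : 0 < β) {x y : ℝ}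
    (hx : β ≤ x) (h0 : thermalGap β H x y = 0) :
    IsLeast (feasibleEnergies β H y) (energy H (gibbs x H)) := by
  have hy : y = freeEnergy β H (gibbs x H) := sub_eq_zero.1 h0
  refine ⟨⟨_, isState_gibbs hH x, hy.ge, rfl⟩, ?_⟩
  rintro _ ⟨η, hη, hle, rfl⟩
  exact energy_gibbs_le_energy hH hβ hx hη (hy ▸ hle)

/-- If `f(·, y)` is nonnegative at `β` and has no zero in an interval containing `β`, then all
thermal states of the interval are feasible. -/
lemma freeEnergy_gibbs_le_of_ne [Nonempty a] (hH : H.IsHermitian) {y : ℝ} {s : Set ℝ}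
    (hs : s.OrdConnected) (hβs : β ∈ s) (hy : freeEnergy β H (gibbs β H) ≤ y)
    (hne : ∀ x ∈ s, thermalGap β H x y ≠ 0) {x : ℝ} (hx : x ∈ s) :
    freeEnergy β H (gibbs x H) ≤ y := by
  by_contra! hlt
  have hcont : ContinuousOn (fun x => freeEnergy β H (gibbs x H)) s :=
    (continuous_freeEnergy_gibbs hH β).continuousOn
  obtain ⟨z, hz, hzy⟩ := hs.isPreconnected.intermediate_value hβs hx hcont ⟨hy, hlt.le⟩
  exact hne z hz (sub_eq_zero.2 hzy.symm)

/-- Without a zero of `f(·, y)` below `β`, thermal states of negative inverse temperature bring the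
feasible energies arbitrarily close to the top of the spectrum. -/
lemma isLUB_feasibleEnergies [Nonempty a] (hH : H.IsHermitian) {y : ℝ}
    (hy : freeEnergy β H (gibbs β H) ≤ y) (hne : ∀ x ≤ β, thermalGap β H x y ≠ 0) :
    ∃ Emax, IsGreatest (spectrum ℝ H) Emax ∧ IsLUB (feasibleEnergies β H y) Emax := by
  have hfeas : ∀ x ≤ β, freeEnergy β H (gibbs x H) ≤ y := fun x hx =>
    freeEnergy_gibbs_le_of_ne hH Set.ordConnected_Iic (Set.mem_Iic.2 le_rfl) hy hne hx
  have hstate := isState_gibbs hH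
  obtain ⟨V, hV, ε, rfl, hspec⟩ := HeatWitness.exists_eq_conjDiag hH
  obtain ⟨k, hk⟩ := Finite.exists_max ε
  obtain ⟨l, hl⟩ := Finite.exists_min ε
  refine ⟨ε k, ?_, ?_, ?_⟩
  · rw [hspec]; exact ⟨⟨k, rfl⟩, by rintro _ ⟨j, rfl⟩; exact hk j⟩
  · rintro _ ⟨η, hη, -, rfl⟩
    exact (energy_mem_Icc hV hl hk hη).2
  · intro b hb
    refine le_of_forall_pos_le_add fun δ hδ => ?_
    set c := Real.log (Fintype.card a) with hc
    have hc0 : 0 ≤ c := Real.log_natCast_nonneg _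
    -- a temperature with `c / |x| ≤ δ`
    set x := min β (-(c / δ) - 1) with hx
    have hx1 : x ≤ -(c / δ) - 1 := min_le_right _ _
    have hcd : 0 ≤ c / δ := div_nonneg hc0 hδ.le
    have h1 := hb ⟨_, hstate x, hfeas x (min_le_left _ _), rfl⟩
    have h2 := mul_energy_gibbs_le hV ε x k
    set E := energy (conjDiag V ε) (gibbs x (conjDiag V ε))
    have h3 : (-x) * (ε k - E) ≤ (-x) * δ := by
      have : c ≤ (-x) * δ := by
        calc c = (c / δ) * δ := by field_simp
          _ ≤ (-x) * δ := mul_le_mul_of_nonneg_right (by linarith) hδ.le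
      linarith
    have h4 := le_of_mul_le_mul_left h3 (by linarith)
    linarith

/-- Without a zero of `f(·, y)` above `β`, thermal states of high inverse temperature bring the
feasible energies arbitrarily close to the bottom of the spectrum. -/
lemma isGLB_feasibleEnergies [Nonempty a] (hH : H.IsHermitian) {y : ℝ}
    (hy : freeEnergy β H (gibbs β H) ≤ y) (hne : ∀ x ≥ β, thermalGap β H x y ≠ 0) :
    ∃ Emin, IsLeast (spectrum ℝ H) Emin ∧ IsGLB (feasibleEnergies β H y) Emin := by
  have hfeas : ∀ x ≥ β, freeEnergy β H (gibbs x H) ≤ y := fun x hx =>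
    freeEnergy_gibbs_le_of_ne hH Set.ordConnected_Ici (Set.mem_Ici.2 le_rfl) hy hne hx
  have hstate := isState_gibbs hH
  obtain ⟨V, hV, ε, rfl, hspec⟩ := HeatWitness.exists_eq_conjDiag hH
  obtain ⟨k, hk⟩ := Finite.exists_max ε
  obtain ⟨l, hl⟩ := Finite.exists_min ε
  refine ⟨ε l, ?_, ?_, ?_⟩
  · rw [hspec]; exact ⟨⟨l, rfl⟩, by rintro _ ⟨j, rfl⟩; exact hl j⟩
  · rintro _ ⟨η, hη, -, rfl⟩
    exact (energy_mem_Icc hV hl hk hη).1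
  · intro b hb
    refine le_of_forall_pos_le_add fun δ hδ => ?_
    set c := Real.log (Fintype.card a) with hc
    have hc0 : 0 ≤ c := Real.log_natCast_nonneg _
    -- a temperature with `c / x ≤ δ`
    set x := max β (c / δ + 1) with hx
    have hx1 : c / δ + 1 ≤ x := le_max_right _ _
    have hcd : 0 ≤ c / δ := div_nonneg hc0 hδ.le
    have h1 := hb ⟨_, hstate x, hfeas x (le_max_left _ _), rfl⟩
    have h2 := mul_energy_gibbs_le hV ε x l
    set E := energy (conjDiag V ε) (gibbs x (conjDiag V ε))
    have h3 : x * (E - ε l) ≤ x * δ := by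
      have : c ≤ x * δ := by
        calc c = (c / δ) * δ := by field_simp
          _ ≤ x * δ := mul_le_mul_of_nonneg_right (by linarith) hδ.le
      linarith
    have h4 := le_of_mul_le_mul_left h3 (by linarith)
    linarith

end Thermal

/-! ### Bipartite systems and heat processes -/

section Bipartite

variable {a b : Type*} [Fintype a] [Fintype b]

lemma trace_traceOutRight (M : Matrix (a × b) (a × b) ℂ) : (traceOutRight M).trace = M.trace := by
  simp [traceOutRight, trace, Fintype.sum_prod_type]

lemma trace_traceOutLeft (M : Matrix (a × b) (a × b) ℂ) : (traceOutLeft M).trace = M.trace := by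
  simp [traceOutLeft, trace, Fintype.sum_prod_type_right]

lemma IsState.traceOutRight {M : Matrix (a × b) (a × b) ℂ} (h : IsState M) :
    IsState (traceOutRight M) := by
  refine ⟨?_, by rw [trace_traceOutRight, h.2]⟩
  have e : HeatWitness.traceOutRight M = ∑ k, M.submatrix (fun i => (i, k)) (fun i => (i, k)) := by
    ext i j; simp [HeatWitness.traceOutRight, Matrix.sum_apply]
  rw [e]
  exact posSemidef_sum _ fun k _ => h.1.submatrix _

lemma IsState.traceOutLeft {M : Matrix (a × b) (a × b) ℂ} (h : IsState M) :
    IsState (traceOutLeft M) := by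
  refine ⟨?_, by rw [trace_traceOutLeft, h.2]⟩
  have e : HeatWitness.traceOutLeft M = ∑ k, M.submatrix (fun i => (k, i)) (fun i => (k, i)) := by
    ext i j; simp [HeatWitness.traceOutLeft, Matrix.sum_apply]
  rw [e]
  exact posSemidef_sum _ fun k _ => h.1.submatrix _

omit [Fintype a] in
lemma traceOutRight_kronecker (A : Matrix a a ℂ) (B : Matrix b b ℂ) :
    traceOutRight (A ⊗ₖ B) = B.trace • A := by
  ext i j
  simp [traceOutRight, kroneckerMap_apply, trace, ← Finset.mul_sum, mul_comm]

omit [Fintype b] in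
lemma traceOutLeft_kronecker (A : Matrix a a ℂ) (B : Matrix b b ℂ) :
    traceOutLeft (A ⊗ₖ B) = A.trace • B := by
  ext i j
  simp [traceOutLeft, kroneckerMap_apply, trace, ← Finset.sum_mul]

lemma trace_kronecker_one_mul [DecidableEq b] (X : Matrix a a ℂ) (M : Matrix (a × b) (a × b) ℂ) :
    (X ⊗ₖ (1 : Matrix b b ℂ) * M).trace = (X * traceOutRight M).trace := by
  simp only [trace, diag_apply, mul_apply, kroneckerMap_apply, traceOutRight, of_apply,
    Fintype.sum_prod_type, one_apply, Finset.mul_sum]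
  simp only [mul_ite, mul_one, mul_zero, ite_mul, zero_mul, Finset.sum_ite_eq, Finset.mem_univ,
    if_true]
  exact Finset.sum_congr rfl fun i _ => Finset.sum_comm

lemma trace_one_kronecker_mul [DecidableEq a] (Y : Matrix b b ℂ) (M : Matrix (a × b) (a × b) ℂ) :
    ((1 : Matrix a a ℂ) ⊗ₖ Y * M).trace = (Y * traceOutLeft M).trace := by
  simp only [trace, diag_apply, mul_apply, kroneckerMap_apply, traceOutLeft, of_apply,
    Fintype.sum_prod_type_right, one_apply, Finset.mul_sum]
  simp only [ite_mul, one_mul, zero_mul, Finset.sum_ite_eq, Finset.mem_univ, if_true]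
  refine Finset.sum_congr rfl fun i _ => ?_
  exact Finset.sum_comm

lemma energy_kronecker_one [DecidableEq b] (X : Matrix a a ℂ) (M : Matrix (a × b) (a × b) ℂ) :
    energy (X ⊗ₖ (1 : Matrix b b ℂ)) M = energy X (traceOutRight M) :=
  congrArg Complex.re (trace_kronecker_one_mul X M)

lemma energy_one_kronecker [DecidableEq a] (Y : Matrix b b ℂ) (M : Matrix (a × b) (a × b) ℂ) :
    energy ((1 : Matrix a a ℂ) ⊗ₖ Y) M = energy Y (traceOutLeft M) :=
  congrArg Complex.re (trace_one_kronecker_mul Y M)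

variable [DecidableEq a] [DecidableEq b]

lemma conjDiag_kronecker (U : Matrix a a ℂ) (V : Matrix b b ℂ) (d : a → ℝ) (e : b → ℝ) :
    conjDiag U d ⊗ₖ conjDiag V e = conjDiag (U ⊗ₖ V) (fun x => d x.1 * e x.2) := by
  unfold conjDiag
  rw [mul_kronecker_mul, mul_kronecker_mul, diagonal_kronecker_diagonal, conjTranspose_kronecker]
  simp

lemma kronecker_mem_unitaryGroup {U : Matrix a a ℂ} {V : Matrix b b ℂ}
    (hU : U ∈ unitaryGroup a ℂ) (hV : V ∈ unitaryGroup b ℂ) :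
    U ⊗ₖ V ∈ unitaryGroup (a × b) ℂ := kronecker_mem_unitary hU hV

lemma conjDiag_one {U : Matrix a a ℂ} (hU : U ∈ unitaryGroup a ℂ) :
    conjDiag U (fun _ => 1) = 1 := by rw [conjDiag_const hU, one_smul]

lemma conjDiag_submatrix (e : b ≃ a) (U : Matrix a a ℂ) (d : a → ℝ) :
    (conjDiag U d).submatrix e e = conjDiag (U.submatrix e e) (d ∘ e) := by
  unfold conjDiag
  rw [← submatrix_mul_equiv _ _ e e e, ← submatrix_mul_equiv _ _ e e e, conjTranspose_submatrix]
  congr 2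
  ext i j
  simp [diagonal_apply]

lemma submatrix_mem_unitaryGroup (e : b ≃ a) {U : Matrix a a ℂ} (hU : U ∈ unitaryGroup a ℂ) :
    U.submatrix e e ∈ unitaryGroup b ℂ := by
  rw [mem_unitaryGroup_iff, star_eq_conjTranspose, conjTranspose_submatrix, submatrix_mul_equiv,
    unitary_mul_conjTranspose hU, submatrix_one_equiv]

lemma entropy_submatrix (e : b ≃ a) {A : Matrix a a ℂ} (hA : A.IsHermitian) :
    entropy (A.submatrix e e) = entropy A := by
  obtain ⟨U, hU, d, rfl, -⟩ := exists_eq_conjDiag hA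
  rw [conjDiag_submatrix, entropy_conjDiag (submatrix_mem_unitaryGroup e hU), entropy_conjDiag hU]
  exact e.sum_comp fun i => Real.negMulLog (d i)

lemma entropy_reindex (e : a ≃ b) {A : Matrix a a ℂ} (hA : A.IsHermitian) :
    entropy (reindex e e A) = entropy A := entropy_submatrix e.symm hA

lemma entropy_unitary_conj {U A : Matrix a a ℂ} (hU : U ∈ unitaryGroup a ℂ) (hA : A.IsHermitian) :
    entropy (U * A * Uᴴ) = entropy A := by
  obtain ⟨V, hV, d, rfl, -⟩ := exists_eq_conjDiag hA
  have : U * conjDiag V d * Uᴴ = conjDiag (U * V) d := by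
    simp only [conjDiag, conjTranspose_mul, mul_assoc]
  rw [this, entropy_conjDiag hV, entropy_conjDiag (mul_mem hU hV)]

omit [DecidableEq a] [DecidableEq b] in
lemma IsState.kronecker {ρ : Matrix a a ℂ} {σ : Matrix b b ℂ} (hρ : IsState ρ) (hσ : IsState σ) :
    IsState (ρ ⊗ₖ σ) :=
  ⟨hρ.1.kronecker hσ.1, by rw [trace_kronecker, hρ.2, hσ.2, one_mul]⟩

lemma entropy_kronecker {ρ : Matrix a a ℂ} {σ : Matrix b b ℂ} (hρ : IsState ρ) (hσ : IsState σ) :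
    entropy (ρ ⊗ₖ σ) = entropy ρ + entropy σ := by
  obtain ⟨U, hU, p, rfl, hp, hp1⟩ := hρ.exists_eq_conjDiag
  obtain ⟨V, hV, q, rfl, hq, hq1⟩ := hσ.exists_eq_conjDiag
  rw [conjDiag_kronecker, entropy_conjDiag (kronecker_mem_unitaryGroup hU hV), entropy_conjDiag hU,
    entropy_conjDiag hV, Fintype.sum_prod_type]
  simp only [Real.negMulLog_mul, Finset.sum_add_distrib]
  simp only [← Finset.mul_sum, ← Finset.sum_mul, hp1, hq1, one_mul]

/-- The first marginal of the occupations of a product basis. -/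
lemma sum_occupation_kronecker_left {U : Matrix a a ℂ} {V : Matrix b b ℂ}
    (hV : V ∈ unitaryGroup b ℂ) (M : Matrix (a × b) (a × b) ℂ) (d : a → ℝ) :
    ∑ x, occupation (U ⊗ₖ V) M x * d x.1 = ∑ i, occupation U (traceOutRight M) i * d i := by
  have h := energy_kronecker_one (conjDiag U d) M
  rw [← conjDiag_one hV, conjDiag_kronecker, energy_conjDiag, energy_conjDiag] at h
  simpa using h

lemma sum_occupation_kronecker_right {U : Matrix a a ℂ} {V : Matrix b b ℂ}
    (hU : U ∈ unitaryGroup a ℂ) (M : Matrix (a × b) (a × b) ℂ) (d : b → ℝ) :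
    ∑ x, occupation (U ⊗ₖ V) M x * d x.2 = ∑ j, occupation V (traceOutLeft M) j * d j := by
  have h := energy_one_kronecker (conjDiag V d) M
  rw [← conjDiag_one hU, conjDiag_kronecker, energy_conjDiag, energy_conjDiag] at h
  simpa using h

/-- Subadditivity of the von Neumann entropy: Klein's inequality relative to the product of the
marginals. -/
lemma entropy_le_add {M : Matrix (a × b) (a × b) ℂ} (hM : IsState M) :
    entropy M ≤ entropy (traceOutRight M) + entropy (traceOutLeft M) := by
  obtain ⟨U, hU, p, hA, hp, hp1⟩ := hM.traceOutRight.exists_eq_conjDiag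
  obtain ⟨V, hV, q, hB, hq, hq1⟩ := hM.traceOutLeft.exists_eq_conjDiag
  have hl := sum_occupation_kronecker_left (U := U) hV M
  have hr := sum_occupation_kronecker_right (V := V) hU M
  rw [hA, occupation_conjDiag_self hU] at hl
  rw [hB, occupation_conjDiag_self hV] at hr
  have hnn := occupation_nonneg hM.1 (U ⊗ₖ V)
  have hpz : ∀ x : a × b, p x.1 = 0 → occupation (U ⊗ₖ V) M x = 0 := by
    intro x hx
    have h := hl (Pi.single x.1 1)
    simp only [Pi.single_apply, mul_ite, mul_one, mul_zero, Finset.sum_ite_eq', Finset.mem_univ,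
      if_true, hx] at h
    have h2 := (Finset.sum_eq_zero_iff_of_nonneg fun y _ => by
      split_ifs
      exacts [hnn y, le_rfl]).1 h x (Finset.mem_univ x)
    simpa using h2
  have hqz : ∀ x : a × b, q x.2 = 0 → occupation (U ⊗ₖ V) M x = 0 := by
    intro x hx
    have h := hr (Pi.single x.2 1)
    simp only [Pi.single_apply, mul_ite, mul_one, mul_zero, Finset.sum_ite_eq', Finset.mem_univ,
      if_true, hx] at h
    have h2 := (Finset.sum_eq_zero_iff_of_nonneg fun y _ => by
      split_ifs
      exacts [hnn y, le_rfl]).1 h x (Finset.mem_univ x)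
    simpa using h2
  have hk := (klein hM (kronecker_mem_unitaryGroup hU hV) (q := fun x => p x.1 * q x.2)
    (fun x => mul_nonneg (hp _) (hq _))
    (fun x hx => (mul_eq_zero.1 hx).elim (hpz x) (hqz x))).1
  have hlog : ∀ x : a × b, occupation (U ⊗ₖ V) M x * Real.log (p x.1 * q x.2) =
      occupation (U ⊗ₖ V) M x * Real.log (p x.1) + occupation (U ⊗ₖ V) M x * Real.log (q x.2) := by
    intro x
    by_cases h1 : p x.1 = 0
    · simp [hpz x h1]
    by_cases h2 : q x.2 = 0
    · simp [hqz x h2]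
    rw [Real.log_mul h1 h2, mul_add]
  have hone : ∑ x : a × b, p x.1 * q x.2 = 1 := by
    rw [Fintype.sum_prod_type]
    simp only [← Finset.mul_sum, hq1, mul_one, hp1]
  simp only [hlog, Finset.sum_add_distrib] at hk
  rw [hl fun i => Real.log (p i), hr fun j => Real.log (q j), hone] at hk
  rw [hA, hB, entropy_conjDiag hU, entropy_conjDiag hV]
  simp only [Real.negMulLog, neg_mul, Finset.sum_neg_distrib]
  linarith

/-- A state that satisfies the reduction criterion `ρ_AB ≤ 1 ⊗ ρ_B` has a nonnegative conditional
entropy. -/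
lemma entropy_traceOutLeft_le {M : Matrix (a × b) (a × b) ℂ} (hM : IsState M)
    (hred : ((1 : Matrix a a ℂ) ⊗ₖ traceOutLeft M - M).PosSemidef) :
    entropy (traceOutLeft M) ≤ entropy M := by
  obtain ⟨V, hV, q, hB, -, -⟩ := hM.traceOutLeft.exists_eq_conjDiag
  have h1 := one_mem (unitaryGroup a ℂ)
  have hr := sum_occupation_kronecker_right (V := V) h1 M fun j => Real.log (q j)
  rw [hB, occupation_conjDiag_self hV] at hr
  rw [hB, ← conjDiag_one h1, conjDiag_kronecker] at hred
  have h := entropy_ge_of_le hM.1 (kronecker_mem_unitaryGroup h1 hV) hred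
  simp only [one_mul] at h
  rw [hr] at h
  rw [hB, entropy_conjDiag hV]
  simpa only [Real.negMulLog, neg_mul, Finset.sum_neg_distrib] using h

end Bipartite

section Heat

variable {a : Type*} [Fintype a] [DecidableEq a]

omit [DecidableEq a] in
lemma energy_add (H K ρ : Matrix a a ℂ) : energy (H + K) ρ = energy H ρ + energy K ρ := by
  simp [energy, add_mul]

omit [DecidableEq a] in
lemma energy_sub_right (H ρ σ : Matrix a a ℂ) : energy H (ρ - σ) = energy H ρ - energy H σ := by
  simp [energy, mul_sub]

lemma energy_unitary_conj {U H ρ : Matrix a a ℂ} (hU : U ∈ unitaryGroup a ℂ) (hc : Commute U H) :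
    energy H (U * ρ * Uᴴ) = energy H ρ := by
  have : (H * (U * ρ * Uᴴ)).trace = (H * ρ).trace := by
    rw [trace_mul_comm, mul_assoc _ Uᴴ, trace_mul_comm, trace_mul_comm H]
    calc _ = (Uᴴ * (H * U) * ρ).trace := by simp only [mul_assoc]
      _ = (H * ρ).trace := by
        rw [← hc.eq, ← mul_assoc, unitary_conjTranspose_mul hU, one_mul]
      _ = _ := trace_mul_comm _ _
  rw [energy, energy, this]

/-- The final system state of a process witnesses that the heat of the process is an admissible
value of the optimal heat problem: by subadditivity of the entropy and by the minimality of the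
free energy of the environment, the free energy of the system cannot increase. -/
lemma IsProcessHeat.mem_heatValues {β : ℝ} (hβ : 0 < β) {H ρ : Matrix a a ℂ} (hρ : IsState ρ)
    {q : ℝ} (hq : IsProcessHeat β H ρ q) : q ∈ heatValues β H ρ := by
  obtain ⟨m, e, HM, ω, HE, U, η, -, hHE, hω, hU, hc, hη, hηM, rfl⟩ := hq
  have hne : Nonempty (Fin e) := by
    by_contra hempty
    rw [not_nonempty_iff] at hempty
    have : ω = 0 := by rw [← hηM]; ext i j; simp [traceOutRight]
    have h1 := hω.2
    simp [this] at h1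
  have hγ := isState_gibbs hHE β
  set γ := gibbs β HE with hγdef
  set X := ρ ⊗ₖ (ω ⊗ₖ γ) with hX
  have hXs : IsState X := hρ.kronecker (hω.kronecker hγ)
  have hηs : IsState η := by
    rw [hη]
    refine ⟨hXs.1.mul_mul_conjTranspose_same U, ?_⟩
    rw [trace_mul_comm, ← mul_assoc, unitary_conjTranspose_mul hU, one_mul, hXs.2]
  have hX1 : traceOutRight X = ρ := by
    rw [hX, traceOutRight_kronecker, (hω.kronecker hγ).2, one_smul]
  have hX2 : traceOutLeft X = ω ⊗ₖ γ := by
    rw [hX, traceOutLeft_kronecker, hρ.2, one_smul]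
  have hX3 : traceOutRight (traceOutLeft X) = ω := by
    rw [hX2, traceOutRight_kronecker, hγ.2, one_smul]
  have hX4 : traceOutLeft (traceOutLeft X) = γ := by
    rw [hX2, traceOutLeft_kronecker, hω.2, one_smul]
  have hE : ∀ Y : Matrix (a × Fin m × Fin e) (a × Fin m × Fin e) ℂ,
      energy (H ⊗ₖ (1 ⊗ₖ 1) + 1 ⊗ₖ (HM ⊗ₖ 1) + 1 ⊗ₖ (1 ⊗ₖ HE)) Y =
        energy H (traceOutRight Y) + energy HM (traceOutRight (traceOutLeft Y)) +
          energy HE (traceOutLeft (traceOutLeft Y)) := by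
    intro Y
    rw [energy_add, energy_add, one_kronecker_one, energy_kronecker_one, energy_one_kronecker,
      energy_kronecker_one, energy_one_kronecker, energy_one_kronecker]
  have hcons := energy_unitary_conj (ρ := X) hU hc
  rw [← hη, hE, hE, hX1, hX3, hX4, hηM] at hcons
  have hS : entropy η = entropy ρ + (entropy ω + entropy γ) := by
    rw [hη, entropy_unitary_conj hU hXs.isHermitian, entropy_kronecker hρ (hω.kronecker hγ),
      entropy_kronecker hω hγ]
  have hsub1 := entropy_le_add hηs
  have hsub2 := entropy_le_add hηs.traceOutLeft
  rw [hηM] at hsub2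
  have hfree := (entropy_le_gibbs hHE hηs.traceOutLeft.traceOutLeft β).1
  rw [← hγdef] at hfree
  refine ⟨traceOutRight η, hηs.traceOutRight, ?_, ?_⟩
  · unfold freeEnergy
    have h : (entropy ρ - entropy (traceOutRight η)) / β ≤
        energy H ρ - energy H (traceOutRight η) := by
      rw [div_le_iff₀ hβ]
      have e1 : energy H ρ - energy H (traceOutRight η) =
        energy HE (traceOutLeft (traceOutLeft η)) - energy HE γ := by linarith
      rw [e1]
      linarith
    rw [sub_div] at h
    linarith
  · change energy HE (traceOutLeft (traceOutLeft η) - γ) = energy H (ρ - traceOutRight η)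
    rw [energy_sub_right, energy_sub_right]
    linarith

end Heat

/-! ### Multipartite systems and the chain of conditional entropies -/

section States

variable {a b : Type*} [Fintype a] [Fintype b]

lemma IsState.reindex {ρ : Matrix a a ℂ} (h : IsState ρ) (e : a ≃ b) :
    IsState (Matrix.reindex e e ρ) :=
  ⟨h.1.submatrix _, by rw [← h.2, reindex_apply]; exact e.symm.sum_comp fun i => ρ i i⟩

lemma energy_reindex (e : a ≃ b) (H ρ : Matrix a a ℂ) :
    energy (reindex e e H) (reindex e e ρ) = energy H ρ := by
  unfold energy
  rw [reindex_apply, reindex_apply, submatrix_mul_equiv]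
  exact congrArg Complex.re (e.symm.sum_comp fun i => (H * ρ) i i)

lemma convex_setOf_isState : Convex ℝ {ρ : Matrix a a ℂ | IsState ρ} := by
  intro ρ hρ σ hσ s t hs ht hst
  refine ⟨(hρ.1.smul hs).add (hσ.1.smul ht), ?_⟩
  rw [trace_add, trace_smul, trace_smul, hρ.2, hσ.2, ← add_smul, hst, one_smul]

lemma IsState.posSemidef_one_sub [DecidableEq a] {ρ : Matrix a a ℂ} (h : IsState ρ) :
    (1 - ρ).PosSemidef := by
  obtain ⟨U, hU, p, rfl, hp, hp1⟩ := h.exists_eq_conjDiag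
  have e : 1 - conjDiag U p = conjDiag U (fun i => 1 - p i) := by
    rw [sub_eq_iff_eq_add, ← conjDiag_add, ← conjDiag_one hU]
    congr 1; funext i; simp
  rw [e]
  refine conjDiag_posSemidef U fun i => sub_nonneg.2 ?_
  rw [← hp1]
  exact Finset.single_le_sum (f := p) (fun i _ => hp i) (Finset.mem_univ i)

omit [Fintype a] in
/-- Two ways of splitting off a subsystem that agree up to relabelling the bases of the two factors
have the same reduced states, up to relabelling. -/
lemma traceOutRight_reindex_eq_submatrix {c a' b' : Type*} [Fintype b'] (f : c ≃ a × b)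
    (g : c ≃ a' × b') (e₁ : a → a') (e₂ : b ≃ b')
    (h : ∀ x z, f.symm (x, z) = g.symm (e₁ x, e₂ z)) (ρ : Matrix c c ℂ) :
    traceOutRight (Matrix.reindex f f ρ) =
      (traceOutRight (Matrix.reindex g g ρ)).submatrix e₁ e₁ := by
  ext x y
  simp only [traceOutRight, of_apply, reindex_apply, submatrix_apply, h]
  exact e₂.sum_comp fun z => ρ (g.symm (e₁ x, z)) (g.symm (e₁ y, z))

end States

section Multipartite

variable {ι : Type*} [Fintype ι] [DecidableEq ι] {α : ι → Type*} [∀ k, Fintype (α k)]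
  [∀ k, DecidableEq (α k)]

omit [DecidableEq ι] [∀ k, Fintype (α k)] [∀ k, DecidableEq (α k)] in
lemma tensor_isHermitian {A : ∀ k, Matrix (α k) (α k) ℂ} (hA : ∀ k, (A k).IsHermitian) :
    (tensor A).IsHermitian := by
  ext x y
  simp only [conjTranspose_apply, tensor, of_apply, star_prod]
  exact Finset.prod_congr rfl fun k _ => (hA k).apply _ _

omit [∀ k, DecidableEq (α k)] in
lemma tensor_mul (A B : ∀ k, Matrix (α k) (α k) ℂ) :
    tensor A * tensor B = tensor fun k => A k * B k := by
  ext x y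
  simp only [mul_apply, tensor, of_apply, ← Finset.prod_mul_distrib]
  rw [Finset.prod_univ_sum, Fintype.piFinset_univ]

omit [∀ k, DecidableEq (α k)] in
lemma trace_tensor (A : ∀ k, Matrix (α k) (α k) ℂ) : (tensor A).trace = ∏ k, (A k).trace := by
  simp only [trace, diag_apply, tensor, of_apply]
  rw [Finset.prod_univ_sum, Fintype.piFinset_univ]

lemma isState_tensor {σ : ∀ k, Matrix (α k) (α k) ℂ} (hσ : ∀ k, IsState (σ k)) :
    IsState (tensor σ) := by
  refine ⟨?_, by rw [trace_tensor]; exact Finset.prod_eq_one fun k _ => (hσ k).2⟩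
  have hroot : ∀ k, ∃ B : Matrix (α k) (α k) ℂ, σ k = Bᴴ * B := fun k => by
    obtain ⟨U, hU, p, hp, hp0, -⟩ := (hσ k).exists_eq_conjDiag
    refine ⟨conjDiag U fun i => √(p i), ?_⟩
    rw [(conjDiag_isHermitian _ _).eq, conjDiag_mul hU, hp]
    simp only [Real.mul_self_sqrt (hp0 _)]
  choose B hB using hroot
  have : tensor σ = (tensor B)ᴴ * tensor B := by
    have h2 : (tensor B)ᴴ = tensor fun k => (B k)ᴴ := by
      ext x y; simp [tensor, conjTranspose_apply]
    rw [h2, tensor_mul]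
    congr 1; funext k; exact hB k
  rw [this]
  exact posSemidef_conjTranspose_mul_self _

lemma IsSeparableState.isState {ρ : Matrix (∀ k, α k) (∀ k, α k) ℂ} (h : IsSeparableState ρ) :
    IsState ρ := by
  refine convexHull_min ?_ convex_setOf_isState h
  rintro _ ⟨σ, hσ, rfl⟩
  exact isState_tensor hσ

omit [∀ k, DecidableEq (α k)] in
lemma IsState.localState {ρ : Matrix (∀ k, α k) (∀ k, α k) ℂ} (h : IsState ρ) (k : ι) :
    IsState (localState k ρ) := (h.reindex _).traceOutRight

omit [∀ k, DecidableEq (α k)] in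
lemma IsState.marginal {ρ : Matrix (∀ k, α k) (∀ k, α k) ℂ} (h : IsState ρ) (p : ι → Prop)
    [DecidablePred p] : IsState (marginal p ρ) := (h.reindex _).traceOutRight

omit [∀ k, Fintype (α k)] in
lemma reindex_tensor_mulSingle (k : ι) (X : Matrix (α k) (α k) ℂ) :
    reindex (Equiv.piSplitAt k α) (Equiv.piSplitAt k α) (tensor (Pi.mulSingle k X)) =
      X ⊗ₖ (1 : Matrix (∀ j : {j // j ≠ k}, α j) (∀ j : {j // j ≠ k}, α j) ℂ) := by
  have h : ∀ x y : ∀ k, α k, tensor (Pi.mulSingle k X) x y =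
      (X ⊗ₖ (1 : Matrix (∀ j : {j // j ≠ k}, α j) (∀ j : {j // j ≠ k}, α j) ℂ))
        (Equiv.piSplitAt k α x) (Equiv.piSplitAt k α y) := by
    intro x y
    simp only [tensor, of_apply, kroneckerMap_apply]
    rw [Fintype.prod_eq_mul_prod_subtype_ne _ k, Pi.mulSingle_eq_same]
    congr 1
    have h1 : ∀ j : {j // j ≠ k}, (Pi.mulSingle k X : ∀ k, Matrix (α k) (α k) ℂ) j (x j) (y j) =
        if x j = y j then 1 else 0 := fun j => by
      rw [Pi.mulSingle_eq_of_ne j.2, one_apply]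
    simp only [h1, Finset.prod_ite_zero, Finset.prod_const_one, one_apply]
    congr 1
    simp only [Equiv.piSplitAt_apply, funext_iff, Finset.mem_univ, true_imp_iff]
  ext u v
  rw [reindex_apply, submatrix_apply, h, Equiv.apply_symm_apply, Equiv.apply_symm_apply]

lemma energy_totalHamiltonian (h : ∀ k, Matrix (α k) (α k) ℂ)
    (ρ : Matrix (∀ k, α k) (∀ k, α k) ℂ) :
    energy (totalHamiltonian h) ρ = ∑ k, energy (h k) (localState k ρ) := by
  have e : energy (totalHamiltonian h) ρ = ∑ k, energy (tensor (Pi.mulSingle k (h k))) ρ := by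
    simp only [energy, totalHamiltonian, Finset.sum_mul, trace_sum, Complex.re_sum]
  rw [e]
  refine Finset.sum_congr rfl fun k _ => ?_
  rw [← energy_reindex (Equiv.piSplitAt k α), reindex_tensor_mulSingle, energy_kronecker_one]
  rfl

omit [∀ k, Fintype (α k)] in
lemma totalHamiltonian_isHermitian {h : ∀ k, Matrix (α k) (α k) ℂ}
    (hh : ∀ k, (h k).IsHermitian) : (totalHamiltonian h).IsHermitian := by
  have key : ∀ k, (tensor (Pi.mulSingle k (h k))).IsHermitian := fun k => by
    refine tensor_isHermitian fun j => ?_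
    by_cases hj : j = k
    · subst hj; rw [Pi.mulSingle_eq_same]; exact hh j
    · rw [Pi.mulSingle_eq_of_ne hj]; exact isHermitian_one
  unfold IsHermitian totalHamiltonian
  rw [conjTranspose_sum]
  exact Finset.sum_congr rfl fun k _ => (key k).eq

/-! ### Marginals -/

lemma entropy_marginal_congr {p q : ι → Prop} [DecidablePred p] [DecidablePred q]
    (h : ∀ j, p j ↔ q j) (ρ : Matrix (∀ k, α k) (∀ k, α k) ℂ) :
    entropy (marginal p ρ) = entropy (marginal q ρ) := by
  obtain rfl : p = q := funext fun j => propext (h j)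
  congr!

lemma entropy_marginal_of_forall {p : ι → Prop} [DecidablePred p] (h : ∀ j, p j)
    {ρ : Matrix (∀ k, α k) (∀ k, α k) ℂ} (hρ : IsState ρ) :
    entropy (marginal p ρ) = entropy ρ := by
  have : IsEmpty {j // ¬p j} := ⟨fun j => j.2 (h j)⟩
  let e : (∀ k : {k // p k}, α k) ≃ (∀ k, α k) :=
    ((Equiv.piEquivPiSubtypeProd p α).trans (Equiv.prodUnique _ _)).symm
  have he : marginal p ρ = ρ.submatrix e e := by
    ext x y
    simp only [marginal, traceOutRight, of_apply, Fintype.sum_unique]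
    rfl
  rw [he, entropy_submatrix e hρ.isHermitian]

/-- Configurations of the parties in `p` are configurations of the party `k` together with
configurations of the other parties in `p`, namely those in `q`. -/
def splitOff {p q : ι → Prop} (k : ι) (hk : p k) (hq : ∀ j, q j ↔ p j ∧ j ≠ k) :
    (∀ j : {j // p j}, α j) ≃ α k × (∀ j : {j // q j}, α j) where
  toFun x := (x ⟨k, hk⟩, fun j => x ⟨j, ((hq j).1 j.2).1⟩)
  invFun y j := if h : j.1 = k then h ▸ y.1 else y.2 ⟨j, (hq j).2 ⟨j.2, h⟩⟩
  left_inv x := by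
    funext ⟨j, hj⟩
    by_cases h : j = k
    · subst h; simp
    · simp [h]
  right_inv y := by
    refine Prod.ext (by simp) ?_
    funext ⟨j, hj⟩
    simp [((hq j).1 hj).2]

omit [Fintype ι] [∀ k, Fintype (α k)] [∀ k, DecidableEq (α k)] in
lemma splitOff_symm_apply_self {p q : ι → Prop} (k : ι) (hk : p k)
    (hq : ∀ j, q j ↔ p j ∧ j ≠ k) (y : α k × (∀ j : {j // q j}, α j)) :
    (splitOff k hk hq).symm y ⟨k, hk⟩ = y.1 := by simp [splitOff]

omit [Fintype ι] [∀ k, Fintype (α k)] [∀ k, DecidableEq (α k)] in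
lemma splitOff_symm_apply_of_ne {p q : ι → Prop} (k : ι) (hk : p k)
    (hq : ∀ j, q j ↔ p j ∧ j ≠ k) (y : α k × (∀ j : {j // q j}, α j)) {j : ι} (hj : p j)
    (hne : j ≠ k) : (splitOff k hk hq).symm y ⟨j, hj⟩ = y.2 ⟨j, (hq j).2 ⟨hj, hne⟩⟩ := by
  simp [splitOff, hne]

omit [Fintype ι] [∀ k, Fintype (α k)] [∀ k, DecidableEq (α k)] [DecidableEq ι] in
lemma piEquivPiSubtypeProd_symm_of_pos {p : ι → Prop} [DecidablePred p]
    (y : (∀ j : {j // p j}, α j) × (∀ j : {j // ¬p j}, α j)) {j : ι} (hj : p j) :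
    (Equiv.piEquivPiSubtypeProd p α).symm y j = y.1 ⟨j, hj⟩ := by
  simp [Equiv.piEquivPiSubtypeProd, hj]

omit [Fintype ι] [∀ k, Fintype (α k)] [∀ k, DecidableEq (α k)] [DecidableEq ι] in
lemma piEquivPiSubtypeProd_symm_of_neg {p : ι → Prop} [DecidablePred p]
    (y : (∀ j : {j // p j}, α j) × (∀ j : {j // ¬p j}, α j)) {j : ι} (hj : ¬p j) :
    (Equiv.piEquivPiSubtypeProd p α).symm y j = y.2 ⟨j, hj⟩ := by
  simp [Equiv.piEquivPiSubtypeProd, hj]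

lemma entropy_marginal_eq_localState {p : ι → Prop} [DecidablePred p] {k : ι}
    (h : ∀ j, p j ↔ j = k) {ρ : Matrix (∀ k, α k) (∀ k, α k) ℂ} (hρ : IsState ρ) :
    entropy (marginal p ρ) = entropy (localState k ρ) := by
  have hp : p k := (h k).2 rfl
  let e₁ : α k ≃ (∀ j : {j // p j}, α j) :=
    ((splitOff (q := fun _ => False) k hp (fun j => by rw [h]; simp)).trans
      (Equiv.prodUnique _ _)).symm
  let e₂ : (∀ j : {j // j ≠ k}, α j) ≃ (∀ j : {j // ¬p j}, α j) :=
    { toFun := fun z j => z ⟨j, fun hj => j.2 ((h j).2 hj)⟩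
      invFun := fun z j => z ⟨j, fun hj => j.2 ((h j).1 hj)⟩
      left_inv := fun _ => rfl
      right_inv := fun _ => rfl }
  have e : localState k ρ = (marginal p ρ).submatrix e₁ e₁ := by
    refine traceOutRight_reindex_eq_submatrix _ _ e₁ e₂ (fun x z => ?_) ρ
    funext j
    by_cases hj : j = k
    · subst hj
      rw [piEquivPiSubtypeProd_symm_of_pos _ hp]
      simp [Equiv.piSplitAt, e₁, splitOff]
    · rw [piEquivPiSubtypeProd_symm_of_neg _ (fun h' => hj ((h j).1 h'))]
      simp [Equiv.piSplitAt, hj, e₂]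
  rw [e, entropy_submatrix e₁ (hρ.marginal _).isHermitian]

section SplitOff

variable {p q : ι → Prop} [DecidablePred p] [DecidablePred q] (k : ι) (hk : p k)
  (hq : ∀ j, q j ↔ p j ∧ j ≠ k)

/-- The reduced state of the parties in `p`, as a bipartite state of the party `k` and the
parties in `q`. -/
def splitMarginal (ρ : Matrix (∀ k, α k) (∀ k, α k) ℂ) :
    Matrix (α k × (∀ j : {j // q j}, α j)) (α k × (∀ j : {j // q j}, α j)) ℂ :=
  reindex (splitOff k hk hq) (splitOff k hk hq) (marginal p ρ)

omit [∀ k, DecidableEq (α k)] in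
lemma traceOutLeft_splitMarginal (ρ : Matrix (∀ k, α k) (∀ k, α k) ℂ) :
    traceOutLeft (splitMarginal k hk hq ρ) = marginal q ρ := by
  have hq' : ∀ j, ¬p j ↔ ¬q j ∧ j ≠ k := fun j => by
    rw [hq]
    by_cases hj : j = k
    · subst hj; simp [hk]
    · simp [hj]
  let e₂ : (∀ j : {j // ¬q j}, α j) ≃ α k × (∀ j : {j // ¬p j}, α j) :=
    splitOff k (fun h => ((hq k).1 h).2 rfl) hq'
  have key : ∀ (x : ∀ j : {j // q j}, α j) (w : α k × (∀ j : {j // ¬p j}, α j)),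
      (Equiv.piEquivPiSubtypeProd p α).symm ((splitOff k hk hq).symm (w.1, x), w.2) =
        (Equiv.piEquivPiSubtypeProd q α).symm (x, e₂.symm w) := by
    intro x w
    funext j
    by_cases hj : j = k
    · subst hj
      rw [piEquivPiSubtypeProd_symm_of_pos _ hk]
      dsimp only
      rw [splitOff_symm_apply_self,
        piEquivPiSubtypeProd_symm_of_neg _ (fun h => ((hq j).1 h).2 rfl)]
      exact (splitOff_symm_apply_self j _ _ w).symm
    · by_cases hpj : p j
      · rw [piEquivPiSubtypeProd_symm_of_pos _ hpj]
        dsimp only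
        rw [splitOff_symm_apply_of_ne k hk hq _ hpj hj,
          piEquivPiSubtypeProd_symm_of_pos _ ((hq j).2 ⟨hpj, hj⟩)]
      · rw [piEquivPiSubtypeProd_symm_of_neg _ hpj,
          piEquivPiSubtypeProd_symm_of_neg _ (fun h => hpj ((hq j).1 h).1)]
        exact (splitOff_symm_apply_of_ne k _ hq' w _ hj).symm
  ext x y
  simp only [traceOutLeft, splitMarginal, marginal, traceOutRight, of_apply, reindex_apply,
    submatrix_apply]
  rw [← Fintype.sum_prod_type' (f := fun a z =>
    ρ ((Equiv.piEquivPiSubtypeProd p α).symm ((splitOff k hk hq).symm (a, x), z))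
      ((Equiv.piEquivPiSubtypeProd p α).symm ((splitOff k hk hq).symm (a, y), z)))]
  simp only [key]
  exact e₂.symm.sum_comp fun z => ρ ((Equiv.piEquivPiSubtypeProd q α).symm (x, z))
    ((Equiv.piEquivPiSubtypeProd q α).symm (y, z))

omit [DecidableEq ι] [∀ k, Fintype (α k)] [∀ k, DecidableEq (α k)] in
lemma reindex_tensor (σ : ∀ k, Matrix (α k) (α k) ℂ) :
    reindex (Equiv.piEquivPiSubtypeProd p α) (Equiv.piEquivPiSubtypeProd p α) (tensor σ) =
      tensor (fun j : {j // p j} => σ j) ⊗ₖ tensor (fun j : {j // ¬p j} => σ j) := by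
  ext u v
  simp only [reindex_apply, submatrix_apply, tensor, of_apply, kroneckerMap_apply]
  rw [← Fintype.prod_subtype_mul_prod_subtype p]
  congr 1
  · exact Finset.prod_congr rfl fun j _ => by
      rw [piEquivPiSubtypeProd_symm_of_pos _ j.2, piEquivPiSubtypeProd_symm_of_pos _ j.2]
  · exact Finset.prod_congr rfl fun j _ => by
      rw [piEquivPiSubtypeProd_symm_of_neg _ j.2, piEquivPiSubtypeProd_symm_of_neg _ j.2]

omit [∀ k, DecidableEq (α k)] in
lemma marginal_tensor {σ : ∀ k, Matrix (α k) (α k) ℂ} (hσ : ∀ k, IsState (σ k)) :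
    marginal p (tensor σ) = tensor (fun j : {j // p j} => σ j) := by
  rw [marginal, reindex_tensor, traceOutRight_kronecker, trace_tensor,
    Finset.prod_eq_one fun (j : {j // ¬p j}) _ => (hσ j).2, one_smul]

omit [∀ k, DecidableEq (α k)] in
lemma splitMarginal_tensor {σ : ∀ k, Matrix (α k) (α k) ℂ} (hσ : ∀ k, IsState (σ k)) :
    splitMarginal k hk hq (tensor σ) = σ k ⊗ₖ tensor (fun j : {j // q j} => σ j) := by
  have h : ∀ x y : ∀ j : {j // p j}, α j, tensor (fun j : {j // p j} => σ j) x y =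
      (σ k ⊗ₖ tensor (fun j : {j // q j} => σ j)) (splitOff k hk hq x) (splitOff k hk hq y) := by
    intro x y
    simp only [tensor, of_apply, kroneckerMap_apply]
    rw [Fintype.prod_eq_mul_prod_subtype_ne _ ⟨k, hk⟩]
    congr 1
    let e : {j : {j // p j} // j ≠ ⟨k, hk⟩} ≃ {j // q j} :=
      { toFun := fun j => ⟨j, (hq j).2 ⟨j.1.2, fun h => j.2 (Subtype.ext h)⟩⟩
        invFun := fun j => ⟨⟨j, ((hq j).1 j.2).1⟩, fun h =>
          ((hq j).1 j.2).2 (congrArg Subtype.val h)⟩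
        left_inv := fun _ => rfl
        right_inv := fun _ => rfl }
    exact Fintype.prod_equiv e _ _ fun j => rfl
  ext u v
  rw [splitMarginal, marginal_tensor hσ, reindex_apply, submatrix_apply, h,
    Equiv.apply_symm_apply, Equiv.apply_symm_apply]

/-- Separable states satisfy the reduction criterion `ρ_AB ≤ 1 ⊗ ρ_B`. -/
lemma IsSeparableState.reduction {ρ : Matrix (∀ k, α k) (∀ k, α k) ℂ} (h : IsSeparableState ρ) :
    ((1 : Matrix (α k) (α k) ℂ) ⊗ₖ traceOutLeft (splitMarginal k hk hq ρ) -
      splitMarginal k hk hq ρ).PosSemidef := by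
  refine convexHull_min (t := {ρ | ((1 : Matrix (α k) (α k) ℂ) ⊗ₖ
    traceOutLeft (splitMarginal k hk hq ρ) - splitMarginal k hk hq ρ).PosSemidef}) ?_ ?_ h
  · rintro _ ⟨σ, hσ, rfl⟩
    have hT := isState_tensor fun j : {j // q j} => hσ j
    have e : (1 : Matrix (α k) (α k) ℂ) ⊗ₖ traceOutLeft (splitMarginal k hk hq (tensor σ)) -
        splitMarginal k hk hq (tensor σ) =
        (1 - σ k) ⊗ₖ tensor (fun j : {j // q j} => σ j) := by
      rw [splitMarginal_tensor k hk hq hσ, traceOutLeft_kronecker, (hσ k).2, one_smul]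
      ext u v
      simp [kroneckerMap_apply, sub_mul]
    rw [Set.mem_ofPred_eq, e]
    exact (hσ k).posSemidef_one_sub.kronecker hT.1
  · intro ρ hρ σ hσ s t hs ht hst
    have e := (hρ.smul hs).add (hσ.smul ht)
    rw [Set.mem_ofPred_eq]
    convert e using 1
    ext u v
    simp only [splitMarginal, marginal, traceOutLeft, traceOutRight, Matrix.sub_apply,
      Matrix.add_apply, Matrix.smul_apply, kroneckerMap_apply, of_apply, reindex_apply,
      submatrix_apply, Finset.sum_add_distrib, mul_add, ← Finset.smul_sum, mul_smul_comm, smul_sub]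
    abel

include hk hq in
/-- Discarding a party does not increase the entropy of a separable state. -/
lemma entropy_marginal_le {ρ : Matrix (∀ k, α k) (∀ k, α k) ℂ} (h : IsSeparableState ρ) :
    entropy (marginal q ρ) ≤ entropy (marginal p ρ) := by
  have hs := h.isState.marginal p
  have h1 := entropy_traceOutLeft_le (hs.reindex (splitOff k hk hq)) (h.reduction k hk hq)
  rw [entropy_reindex _ hs.isHermitian] at h1
  rw [← traceOutLeft_splitMarginal k hk hq]
  exact h1

end SplitOff

end Multipartite

section Chain

variable {n : ℕ} {α : Fin (n + 1) → Type*} [∀ k, Fintype (α k)] [∀ k, DecidableEq (α k)]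

/-- The chain rule for the von Neumann entropy: the conditional entropies telescope. -/
lemma entropy_eq_add_entropyChain {ρ : Matrix (∀ k, α k) (∀ k, α k) ℂ} (hρ : IsState ρ) :
    entropy ρ = entropy (localState (Fin.last n) ρ) + entropyChain ρ := by
  let g : Fin (n + 1) → ℝ := fun k => entropy (marginal (fun j => k ≤ j) ρ)
  have h0 : g 0 = entropy ρ := entropy_marginal_of_forall (fun j => Fin.zero_le j) hρ
  have hl : g (Fin.last n) = entropy (localState (Fin.last n) ρ) :=
    entropy_marginal_eq_localState (fun j => Fin.last_le_iff) hρ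
  have hc : entropyChain ρ = ∑ k : Fin n, (g k.castSucc - g k.succ) := by
    refine Finset.sum_congr rfl fun k _ => ?_
    rw [condEntropy]
    rw [entropy_marginal_congr (fun j => Fin.castSucc_lt_iff_succ_le) ρ]
  have h1 := Fin.sum_univ_castSucc g
  have h2 := Fin.sum_univ_succ g
  rw [hc, Finset.sum_sub_distrib, ← h0, ← hl]
  linarith

lemma entropyChain_nonneg {ρ : Matrix (∀ k, α k) (∀ k, α k) ℂ} (hρ : IsSeparableState ρ) :
    0 ≤ entropyChain ρ :=
  Finset.sum_nonneg fun k _ => sub_nonneg.2 <|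
    entropy_marginal_le k.castSucc le_rfl (fun j => by rw [lt_iff_le_and_ne, ne_comm]) hρ

lemma freeEnergy_eq_sum {ρ : Matrix (∀ k, α k) (∀ k, α k) ℂ} (hρ : IsState ρ) (β : ℝ)
    (h : ∀ k, Matrix (α k) (α k) ℂ) :
    freeEnergy β (totalHamiltonian h) ρ = ∑ k, freeEnergy β (h k) (localState k ρ) +
      β⁻¹ * (∑ k : Fin n, entropy (localState k.castSucc ρ) - entropyChain ρ) := by
  have h1 := Fin.sum_univ_castSucc fun k => entropy (localState k ρ)
  simp only [freeEnergy, Finset.sum_sub_distrib]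
  rw [energy_totalHamiltonian, entropy_eq_add_entropyChain hρ, ← Finset.sum_div, h1, div_eq_inv_mul,
    div_eq_inv_mul]
  ring

end Chain

/-! ### Compactness and attained optima -/

section ConvexHull

variable {E : Type*} [AddCommGroup E] [Module ℝ E] [TopologicalSpace E] [ContinuousAdd E]
  [ContinuousSMul ℝ E]

lemma isCompact_convexJoin {s t : Set E} (hs : IsCompact s) (ht : IsCompact t) :
    IsCompact (convexJoin ℝ s t) := by
  have h : convexJoin ℝ s t = (fun z : ℝ × E × E => (1 - z.1) • z.2.1 + z.1 • z.2.2) ''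
      (Set.Icc (0 : ℝ) 1 ×ˢ s ×ˢ t) := by
    ext x
    simp only [mem_convexJoin, segment_eq_image, Set.mem_image, Set.mem_prod, Prod.exists]
    constructor
    · rintro ⟨a, ha, b, hb, θ, hθ, rfl⟩
      exact ⟨θ, a, b, ⟨hθ, ha, hb⟩, rfl⟩
    · rintro ⟨θ, a, b, ⟨hθ, ha, hb⟩, rfl⟩
      exact ⟨a, ha, b, hb, θ, hθ, rfl⟩
  rw [h]
  exact (isCompact_Icc.prod (hs.prod ht)).image (by fun_prop)

/-- In finite dimension the convex hull of a compact set `K` is compact: by Carathéodory's theorem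
it is a finite union of iterated joins of `K`. -/
lemma isCompact_convexHull_of_finiteDimensional [FiniteDimensional ℝ E] {K : Set E}
    (hK : IsCompact K) : IsCompact (convexHull ℝ K) := by
  let C : ℕ → Set E := fun n => (convexJoin ℝ K)^[n] K
  have hC : ∀ n, C (n + 1) = convexJoin ℝ K (C n) := fun n => Function.iterate_succ_apply' _ _ _
  have hcomp : ∀ n, IsCompact (C n) := by
    intro n
    induction n with
    | zero => exact hK
    | succ n ih => rw [hC]; exact isCompact_convexJoin hK ih
  have hsub : ∀ n, C n ⊆ convexHull ℝ K := by
    intro n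
    induction n with
    | zero => exact subset_convexHull ℝ K
    | succ n ih =>
      rw [hC]
      exact convexJoin_subset (subset_convexHull ℝ K) ih (convex_convexHull ℝ K)
  have hfin : ∀ (n : ℕ) (t : Finset E), t.card = n + 1 → ↑t ⊆ K → convexHull ℝ (t : Set E) ⊆ C n := by
    classical
    intro n
    induction n with
    | zero =>
      intro t ht htK
      obtain ⟨x, rfl⟩ := Finset.card_eq_one.1 ht
      simpa [C] using htK
    | succ n ih =>
      intro t ht htK
      obtain ⟨x, u, hxu, rfl, hu⟩ := Finset.card_eq_succ.1 ht
      have hne : (u : Set E).Nonempty := by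
        rw [Finset.coe_nonempty, ← Finset.card_pos]; omega
      rw [Finset.coe_insert, convexHull_insert hne, hC]
      rw [Finset.coe_insert, Set.insert_subset_iff] at htK
      exact convexJoin_mono (Set.singleton_subset_iff.2 htK.1) (ih u hu htK.2)
  have heq : convexHull ℝ K = ⋃ n ∈ Finset.range (Module.finrank ℝ E + 1), C n := by
    apply Set.Subset.antisymm
    · intro x hx
      rw [convexHull_eq_union] at hx
      simp only [Set.mem_iUnion, exists_prop] at hx
      obtain ⟨t, htK, hind, hxt⟩ := hx
      have hcard := hind.card_le_finrank_succ
      have hle := Submodule.finrank_le (vectorSpan ℝ (Set.range ((↑) : t → E)))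
      rw [Fintype.card_coe] at hcard
      have hpos : 0 < t.card := by
        rw [Finset.card_pos, ← Finset.coe_nonempty, ← convexHull_nonempty_iff (𝕜 := ℝ)]
        exact ⟨x, hxt⟩
      simp only [Set.mem_iUnion, Finset.mem_range, exists_prop]
      exact ⟨t.card - 1, by omega, hfin _ t (by omega) htK hxt⟩
    · simp only [Set.iUnion_subset_iff]
      exact fun n _ => hsub n
  rw [heq]
  exact (Finset.range _).isCompact_biUnion fun n _ => hcomp n

end ConvexHull

section States

variable {a : Type*} [Fintype a]

lemma continuous_energy (H : Matrix a a ℂ) : Continuous (energy H) := by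
  unfold energy
  fun_prop

variable [DecidableEq a]

lemma isCompact_unitaryGroup : IsCompact (unitaryGroup a ℂ : Set (Matrix a a ℂ)) := by
  have hclosed : IsClosed (unitaryGroup a ℂ : Set (Matrix a a ℂ)) := by
    have : (unitaryGroup a ℂ : Set (Matrix a a ℂ)) = {U | U * star U = 1} := by
      ext U; exact mem_unitaryGroup_iff
    rw [this]
    exact isClosed_eq (by fun_prop) continuous_const
  have hbox : IsCompact (Set.univ.pi fun _ => Set.univ.pi fun _ => Metric.closedBall 0 1 :
      Set (Matrix a a ℂ)) :=
    isCompact_univ_pi fun _ => isCompact_univ_pi fun _ => isCompact_closedBall (0 : ℂ) 1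
  refine hbox.of_isClosed_subset hclosed fun U hU i _ j _ => ?_
  rw [mem_closedBall_zero_iff]
  exact entry_norm_bound_of_unitary hU i j

/-- Spectral data of states: an orthonormal basis and a probability vector. -/
def spectralData (a : Type*) [Fintype a] [DecidableEq a] : Set (Matrix a a ℂ × (a → ℝ)) :=
  (unitaryGroup a ℂ : Set (Matrix a a ℂ)) ×ˢ stdSimplex ℝ a

lemma isCompact_spectralData : IsCompact (spectralData a) :=
  isCompact_unitaryGroup.prod (isCompact_stdSimplex ℝ a)

lemma continuous_conjDiag : Continuous fun z : Matrix a a ℂ × (a → ℝ) => conjDiag z.1 z.2 := by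
  unfold conjDiag
  have : Continuous fun z : Matrix a a ℂ × (a → ℝ) => diagonal fun i => ((z.2 i : ℝ) : ℂ) :=
    Continuous.matrix_diagonal (by fun_prop)
  fun_prop

lemma image_spectralData :
    (fun z : Matrix a a ℂ × (a → ℝ) => conjDiag z.1 z.2) '' spectralData a =
      {ρ | IsState ρ} := by
  ext ρ
  constructor
  · rintro ⟨⟨U, p⟩, ⟨hU, hp, hp1⟩, rfl⟩
    exact isState_conjDiag hU hp hp1
  · intro hρ
    obtain ⟨U, hU, p, rfl, hp, hp1⟩ := IsState.exists_eq_conjDiag hρ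
    exact ⟨(U, p), ⟨hU, hp, hp1⟩, rfl⟩

lemma isCompact_setOf_isState : IsCompact {ρ : Matrix a a ℂ | IsState ρ} := by
  rw [← image_spectralData]
  exact isCompact_spectralData.image continuous_conjDiag

/-- The entropy is a continuous function of the spectral data, and the set of states is a
topological quotient of the compact set of spectral data. -/
lemma continuousOn_entropy : ContinuousOn entropy {ρ : Matrix a a ℂ | IsState ρ} := by
  have hmem : ∀ z ∈ spectralData a, IsState (conjDiag z.1 z.2) := fun z hz =>
    isState_conjDiag hz.1 hz.2.1 hz.2.2
  let π : spectralData a → {ρ : Matrix a a ℂ | IsState ρ} := fun z =>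
    ⟨conjDiag z.1.1 z.1.2, hmem z.1 z.2⟩
  have hπc : Continuous π :=
    Continuous.subtype_mk (continuous_conjDiag.comp continuous_subtype_val) _
  have hπs : Function.Surjective π := by
    rintro ⟨ρ, hρ⟩
    obtain ⟨U, hU, p, rfl, hp, hp1⟩ := IsState.exists_eq_conjDiag hρ
    exact ⟨⟨(U, p), hU, hp, hp1⟩, rfl⟩
  have : CompactSpace (spectralData a) := isCompact_iff_compactSpace.1 isCompact_spectralData
  have hq := Topology.IsQuotientMap.of_surjective_continuous hπs hπc
  rw [continuousOn_iff_continuous_domRestrict, hq.continuous_iff]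
  have e : Set.domRestrict {ρ : Matrix a a ℂ | IsState ρ} entropy ∘ π =
      fun z => ∑ i, Real.negMulLog (z.1.2 i) := by
    funext z
    exact entropy_conjDiag z.2.1 _
  rw [e]
  exact continuous_finsetSum _ fun i _ => Real.continuous_negMulLog.comp
    ((continuous_apply i).comp (continuous_snd.comp continuous_subtype_val))

lemma continuousOn_freeEnergy (β : ℝ) (H : Matrix a a ℂ) :
    ContinuousOn (freeEnergy β H) {ρ : Matrix a a ℂ | IsState ρ} :=
  (continuous_energy H).continuousOn.sub (continuousOn_entropy.div_const β)

lemma isCompact_feasibleEnergies (β : ℝ) (H : Matrix a a ℂ) (y : ℝ) :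
    IsCompact (feasibleEnergies β H y) := by
  have h : feasibleEnergies β H y =
      energy H '' ({ρ | IsState ρ} ∩ freeEnergy β H ⁻¹' Set.Iic y) := by
    ext e
    constructor
    · rintro ⟨η, hη, hle, rfl⟩; exact ⟨η, ⟨hη, hle⟩, rfl⟩
    · rintro ⟨η, ⟨hη, hle⟩, rfl⟩; exact ⟨η, hη, hle, rfl⟩
  rw [h]
  refine IsCompact.image ?_ (continuous_energy H)
  exact isCompact_setOf_isState.of_isClosed_subset
    ((continuousOn_freeEnergy β H).preimage_isClosed_of_isClosed
      isCompact_setOf_isState.isClosed isClosed_Iic) Set.inter_subset_left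

end States

section HeatValues

variable {a : Type*} [Fintype a] [DecidableEq a] {β : ℝ} {H ρ : Matrix a a ℂ}

lemma heatValues_eq_image (β : ℝ) (H ρ : Matrix a a ℂ) :
    heatValues β H ρ =
      (fun e => energy H ρ - e) '' feasibleEnergies β H (freeEnergy β H ρ) := by
  ext q
  constructor
  · rintro ⟨η, hη, hle, rfl⟩
    exact ⟨_, ⟨η, hη, hle, rfl⟩, (energy_sub_right H ρ η).symm⟩
  · rintro ⟨_, ⟨η, hη, hle, rfl⟩, rfl⟩
    exact ⟨η, hη, hle, (energy_sub_right H ρ η).symm⟩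

lemma isLeast_Qc (hρ : IsState ρ) : IsLeast (heatValues β H ρ) (Qc β H ρ) := by
  refine IsCompact.isLeast_sInf ?_ ⟨_, ρ, hρ, le_rfl, rfl⟩
  rw [heatValues_eq_image]
  exact (isCompact_feasibleEnergies _ _ _).image (by fun_prop)

lemma isGreatest_Qh (hρ : IsState ρ) : IsGreatest (heatValues β H ρ) (Qh β H ρ) := by
  refine IsCompact.isGreatest_sSup ?_ ⟨_, ρ, hρ, le_rfl, rfl⟩
  rw [heatValues_eq_image]
  exact (isCompact_feasibleEnergies _ _ _).image (by fun_prop)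

/-- Pairs of an initial state in `K` and a final state that is admissible for it. -/
def admissiblePairs (β : ℝ) (H : Matrix a a ℂ) (K : Set (Matrix a a ℂ)) :
    Set (Matrix a a ℂ × Matrix a a ℂ) :=
  {z | z.1 ∈ K ∧ IsState z.2 ∧ freeEnergy β H z.2 ≤ freeEnergy β H z.1}

lemma isCompact_admissiblePairs (β : ℝ) (H : Matrix a a ℂ) {K : Set (Matrix a a ℂ)}
    (hK : IsCompact K) (hKs : ∀ ρ ∈ K, IsState ρ) : IsCompact (admissiblePairs β H K) := by
  have h : admissiblePairs β H K = (K ×ˢ {ρ | IsState ρ}) ∩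
      (fun z => freeEnergy β H z.2 - freeEnergy β H z.1) ⁻¹' Set.Iic 0 := by
    ext z
    simp [admissiblePairs, and_assoc]
  have hprod := hK.prod (isCompact_setOf_isState (a := a))
  have hc := continuousOn_freeEnergy β H
  have hcont : ContinuousOn (fun z : Matrix a a ℂ × Matrix a a ℂ =>
      freeEnergy β H z.2 - freeEnergy β H z.1) (K ×ˢ {ρ | IsState ρ}) :=
    (hc.comp continuousOn_snd fun z hz => hz.2).sub
      (hc.comp continuousOn_fst fun z hz => hKs _ hz.1)
  rw [h]
  exact hprod.of_isClosed_subset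
    (hcont.preimage_isClosed_of_isClosed hprod.isClosed isClosed_Iic) Set.inter_subset_left

/-- The optimal heat attains its minimum over a compact set of initial states, because the joint
minimum over initial and final states is attained. -/
lemma isLeast_sInf_image_Qc {K : Set (Matrix a a ℂ)} (hK : IsCompact K) (hne : K.Nonempty)
    (hKs : ∀ ρ ∈ K, IsState ρ) : IsLeast (Qc β H '' K) (sInf (Qc β H '' K)) := by
  obtain ⟨ρ₀, hρ₀⟩ := hne
  obtain ⟨z, hz, hmin⟩ := (isCompact_admissiblePairs β H hK hKs).exists_isMinOn
    ⟨(ρ₀, ρ₀), hρ₀, hKs _ hρ₀, le_rfl⟩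
    (f := fun z => energy H (z.1 - z.2))
    ((continuous_energy H).comp (continuous_fst.sub continuous_snd)).continuousOn
  have hl : IsLeast (Qc β H '' K) (Qc β H z.1) := by
    refine ⟨⟨z.1, hz.1, rfl⟩, ?_⟩
    rintro _ ⟨ρ, hρ, rfl⟩
    obtain ⟨η, hη, hle, hq⟩ := (isLeast_Qc (β := β) (H := H) (hKs ρ hρ)).1
    have h1 : Qc β H z.1 ≤ energy H (z.1 - z.2) :=
      (isLeast_Qc (hKs _ hz.1)).2 ⟨z.2, hz.2.1, hz.2.2, rfl⟩
    rw [hq]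
    exact h1.trans (isMinOn_iff.1 hmin (ρ, η) ⟨hρ, hη, hle⟩)
  rwa [hl.csInf_eq]

lemma isGreatest_sSup_image_Qh {K : Set (Matrix a a ℂ)} (hK : IsCompact K) (hne : K.Nonempty)
    (hKs : ∀ ρ ∈ K, IsState ρ) : IsGreatest (Qh β H '' K) (sSup (Qh β H '' K)) := by
  obtain ⟨ρ₀, hρ₀⟩ := hne
  obtain ⟨z, hz, hmax⟩ := (isCompact_admissiblePairs β H hK hKs).exists_isMaxOn
    ⟨(ρ₀, ρ₀), hρ₀, hKs _ hρ₀, le_rfl⟩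
    (f := fun z => energy H (z.1 - z.2))
    ((continuous_energy H).comp (continuous_fst.sub continuous_snd)).continuousOn
  have hl : IsGreatest (Qh β H '' K) (Qh β H z.1) := by
    refine ⟨⟨z.1, hz.1, rfl⟩, ?_⟩
    rintro _ ⟨ρ, hρ, rfl⟩
    obtain ⟨η, hη, hle, hq⟩ := (isGreatest_Qh (β := β) (H := H) (hKs ρ hρ)).1
    have h1 : energy H (z.1 - z.2) ≤ Qh β H z.1 :=
      (isGreatest_Qh (hKs _ hz.1)).2 ⟨z.2, hz.2.1, hz.2.2, rfl⟩
    rw [hq]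
    exact (isMaxOn_iff.1 hmax (ρ, η) ⟨hρ, hη, hle⟩).trans h1
  rwa [hl.csSup_eq]

lemma csInf_image_const_sub {S : Set ℝ} {M : ℝ} (h : IsGreatest S M) (c : ℝ) :
    sInf ((fun e => c - e) '' S) = c - M :=
  IsLeast.csInf_eq ⟨⟨M, h.1, rfl⟩, by rintro _ ⟨e, he, rfl⟩; exact sub_le_sub_left (h.2 he) c⟩

lemma csSup_image_const_sub {S : Set ℝ} {m : ℝ} (h : IsLeast S m) (c : ℝ) :
    sSup ((fun e => c - e) '' S) = c - m :=
  IsGreatest.csSup_eq ⟨⟨m, h.1, rfl⟩, by rintro _ ⟨e, he, rfl⟩; exact sub_le_sub_left (h.2 he) c⟩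

end HeatValues

section SeparableClass

variable {n : ℕ} {α : Fin (n + 1) → Type*} [∀ k, Fintype (α k)] [∀ k, DecidableEq (α k)]

omit [∀ k, DecidableEq (α k)] in
lemma continuous_localState (k : Fin (n + 1)) :
    Continuous (localState k : Matrix (∀ k, α k) (∀ k, α k) ℂ → Matrix (α k) (α k) ℂ) := by
  refine continuous_matrix fun i j => ?_
  simp only [localState, traceOutRight, of_apply, reindex_apply, submatrix_apply]
  exact continuous_finsetSum _ fun _ _ => continuous_id.matrix_elem _ _

lemma isCompact_setOf_isSeparableState :
    IsCompact {ρ : Matrix (∀ k, α k) (∀ k, α k) ℂ | IsSeparableState ρ} := by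
  refine isCompact_convexHull_of_finiteDimensional ?_
  have h : {τ | ∃ σ : ∀ k, Matrix (α k) (α k) ℂ, (∀ k, IsState (σ k)) ∧ τ = tensor σ} =
      tensor '' (Set.univ.pi fun k => {σ : Matrix (α k) (α k) ℂ | IsState σ}) := by
    ext τ
    constructor
    · rintro ⟨σ, hσ, rfl⟩; exact ⟨σ, fun k _ => hσ k, rfl⟩
    · rintro ⟨σ, hσ, rfl⟩; exact ⟨σ, fun k => hσ k trivial, rfl⟩
  rw [h]
  refine (isCompact_univ_pi fun k => isCompact_setOf_isState).image ?_
  refine continuous_matrix fun x y => ?_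
  simp only [tensor, of_apply]
  exact continuous_finsetProd _ fun k _ => (continuous_apply k).matrix_elem _ _

lemma isCompact_separableClass (h : ∀ k, Matrix (α k) (α k) ℂ) (E s : Fin (n + 1) → ℝ) :
    IsCompact (separableClass h E s) := by
  let f : Matrix (∀ k, α k) (∀ k, α k) ℂ → Fin (n + 1) → ℝ × ℝ := fun ρ k =>
    (energy (h k) (localState k ρ), entropy (localState k ρ))
  have hf : ContinuousOn f {ρ | IsSeparableState ρ} := by
    refine continuousOn_pi.2 fun k => ?_
    refine ((continuous_energy (h k)).comp (continuous_localState k)).continuousOn.prodMk ?_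
    exact continuousOn_entropy.comp (continuous_localState k).continuousOn
      fun ρ hρ => (IsSeparableState.isState hρ).localState k
  have e : separableClass h E s =
      {ρ | IsSeparableState ρ} ∩ f ⁻¹' {fun k => (E k, s k)} := by
    ext ρ
    simp [separableClass, f, funext_iff]
  rw [e]
  exact isCompact_setOf_isSeparableState.of_isClosed_subset
    (hf.preimage_isClosed_of_isClosed isCompact_setOf_isSeparableState.isClosed
      isClosed_singleton) Set.inter_subset_left

variable {h : ∀ k, Matrix (α k) (α k) ℂ} {E s : Fin (n + 1) → ℝ}
  {ρ : Matrix (∀ k, α k) (∀ k, α k) ℂ}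

lemma isState_of_mem_separableClass (hρ : ρ ∈ separableClass h E s) : IsState ρ := hρ.1.isState

lemma energy_of_mem_separableClass (hρ : ρ ∈ separableClass h E s) :
    energy (totalHamiltonian h) ρ = ∑ k, E k := by
  rw [energy_totalHamiltonian]
  exact Finset.sum_congr rfl fun k _ => (hρ.2 k).1

lemma freeEnergy_of_mem_separableClass (β : ℝ) (hρ : ρ ∈ separableClass h E s) :
    freeEnergy β (totalHamiltonian h) ρ = classicalFreeEnergy β E s - β⁻¹ * entropyChain ρ := by
  rw [freeEnergy_eq_sum hρ.1.isState, classicalFreeEnergy]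
  simp only [freeEnergy, (hρ.2 _).1, (hρ.2 _).2]
  ring

/-- At zero chain all entropies but that of the last party cancel. -/
lemma classicalFreeEnergy_eq (β : ℝ) (E s : Fin (n + 1) → ℝ) :
    classicalFreeEnergy β E s = ∑ k, E k - s (Fin.last n) / β := by
  have h1 := Fin.sum_univ_castSucc s
  rw [classicalFreeEnergy, Finset.sum_sub_distrib, ← Finset.sum_div, h1, div_eq_inv_mul,
    div_eq_inv_mul]
  ring

lemma classicalHeatValues_eq_image (β : ℝ) (h : ∀ k, Matrix (α k) (α k) ℂ)
    (E s : Fin (n + 1) → ℝ) :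
    classicalHeatValues β h E s = (fun e => ∑ k, E k - e) ''
      feasibleEnergies β (totalHamiltonian h) (classicalFreeEnergy β E s) := by
  ext q
  constructor
  · rintro ⟨η, hη, hle, rfl⟩
    exact ⟨_, ⟨η, hη, hle, rfl⟩, rfl⟩
  · rintro ⟨_, ⟨η, hη, hle, rfl⟩, rfl⟩
    exact ⟨η, hη, hle, rfl⟩

lemma QcStar_eq {β M : ℝ} (hM : IsGreatest
    (feasibleEnergies β (totalHamiltonian h) (classicalFreeEnergy β E s)) M) :
    QcStar β h E s = ∑ k, E k - M := by
  rw [QcStar, classicalHeatValues_eq_image, csInf_image_const_sub hM]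

lemma QhStar_eq {β m : ℝ} (hm : IsLeast
    (feasibleEnergies β (totalHamiltonian h) (classicalFreeEnergy β E s)) m) :
    QhStar β h E s = ∑ k, E k - m := by
  rw [QhStar, classicalHeatValues_eq_image, csSup_image_const_sub hm]

/-- At a zero of `f(·, F^⋆)` the definition of the free energy turns energies into entropies. -/
lemma sum_sub_energy_gibbs {β x : ℝ}
    (h0 : thermalGap β (totalHamiltonian h) x (classicalFreeEnergy β E s) = 0) :
    ∑ k, E k - energy (totalHamiltonian h) (gibbs x (totalHamiltonian h)) =
      β⁻¹ * (s (Fin.last n) - entropy (gibbs x (totalHamiltonian h))) := by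
  rw [thermalGap, classicalFreeEnergy_eq, freeEnergy, div_eq_inv_mul, div_eq_inv_mul] at h0
  linarith

end SeparableClass

end HeatWitness

/-! ### The classical heat bounds -/

theorem mainTheorem5 {n : ℕ} (α : Fin (n + 1) → Type*) [∀ k, Fintype (α k)]
    [∀ k, DecidableEq (α k)] (h : ∀ k, Matrix (α k) (α k) ℂ) (hh : ∀ k, (h k).IsHermitian)
    (β : ℝ) (hβ : 0 < β) :
    -- chain rule and decomposition of the free energy, for every state
    (∀ ρ : Matrix (∀ k, α k) (∀ k, α k) ℂ, IsState ρ →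
      entropy ρ =
        entropy (localState (Fin.last n) ρ) +
          entropyChain ρ ∧
      freeEnergy β (totalHamiltonian h) ρ =
        ∑ k, freeEnergy β (h k) (localState k ρ) +
          β⁻¹ * (∑ k : Fin n, entropy (localState k.castSucc ρ) -
            entropyChain ρ)) ∧
    -- for separable states the chain is nonnegative
    (∀ ρ : Matrix (∀ k, α k) (∀ k, α k) ℂ, IsSeparableState ρ →
      0 ≤ entropyChain ρ) ∧
    -- the classical bounds, for separable states with given local energies and entropies
    (∀ E s : Fin (n + 1) → ℝ, (separableClass h E s).Nonempty →
      -- the free energy is largest at zero chain, and so are the heat bounds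
      (∀ ρ ∈ separableClass h E s,
        freeEnergy β (totalHamiltonian h) ρ ≤
          classicalFreeEnergy β E s ∧
        (freeEnergy β (totalHamiltonian h) ρ =
          classicalFreeEnergy β E s ↔ entropyChain ρ = 0) ∧
        IsLeast (heatValues β (totalHamiltonian h) ρ)
          (Qc β (totalHamiltonian h) ρ) ∧
        IsGreatest (heatValues β (totalHamiltonian h) ρ)
          (Qh β (totalHamiltonian h) ρ) ∧
        QcStar β h E s ≤ Qc β (totalHamiltonian h) ρ ∧
        Qh β (totalHamiltonian h) ρ ≤ QhStar β h E s ∧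
        (∀ q : ℝ, IsProcessHeat β (totalHamiltonian h) ρ q →
          Qc β (totalHamiltonian h) ρ ≤ q ∧
          q ≤ Qh β (totalHamiltonian h) ρ) ∧
        (entropyChain ρ = 0 →
          Qc β (totalHamiltonian h) ρ = QcStar β h E s ∧
          Qh β (totalHamiltonian h) ρ = QhStar β h E s ∧
          QcClass β h E s = QcStar β h E s ∧
          QhClass β h E s = QhStar β h E s)) ∧
      IsLeast (Qc β (totalHamiltonian h) '' separableClass h E s) (QcClass β h E s) ∧
      IsGreatest (Qh β (totalHamiltonian h) '' separableClass h E s) (QhClass β h E s) ∧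
      QcStar β h E s ≤ QcClass β h E s ∧
      QhClass β h E s ≤ QhStar β h E s ∧
      IsLeast (classicalHeatValues β h E s) (QcStar β h E s) ∧
      IsGreatest (classicalHeatValues β h E s) (QhStar β h E s) ∧
      -- closed form of the classical bounds through the zeros of `f(·, F^⋆)`
      (∀ x₁ x₂ : ℝ, x₁ < x₂ →
        thermalGap β (totalHamiltonian h) x₁
          (classicalFreeEnergy β E s) = 0 →
        thermalGap β (totalHamiltonian h) x₂
          (classicalFreeEnergy β E s) = 0 →
        QcStar β h E s = β⁻¹ * (s (Fin.last n) -
          entropy (gibbs x₁ (totalHamiltonian h))) ∧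
        QhStar β h E s = β⁻¹ * (s (Fin.last n) -
          entropy (gibbs x₂ (totalHamiltonian h)))) ∧
      (∀ x ≤ β, thermalGap β (totalHamiltonian h) x
          (classicalFreeEnergy β E s) = 0 →
        QcStar β h E s = β⁻¹ * (s (Fin.last n) -
          entropy (gibbs x (totalHamiltonian h)))) ∧
      (∀ x ≥ β, thermalGap β (totalHamiltonian h) x
          (classicalFreeEnergy β E s) = 0 →
        QhStar β h E s = β⁻¹ * (s (Fin.last n) -
          entropy (gibbs x (totalHamiltonian h)))) ∧
      -- degenerate cases: without such a zero the spectrum is exhausted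
      ((∀ x ≤ β, thermalGap β (totalHamiltonian h) x
          (classicalFreeEnergy β E s) ≠ 0) →
        ∃ Emax : ℝ, IsGreatest (spectrum ℝ (totalHamiltonian h)) Emax ∧
          QcStar β h E s = ∑ k, E k - Emax) ∧
      ((∀ x ≥ β, thermalGap β (totalHamiltonian h) x
          (classicalFreeEnergy β E s) ≠ 0) →
        ∃ Emin : ℝ, IsLeast (spectrum ℝ (totalHamiltonian h)) Emin ∧
          QhStar β h E s = ∑ k, E k - Emin)) := by
  refine ⟨fun ρ hρ => ⟨entropy_eq_add_entropyChain hρ, freeEnergy_eq_sum hρ β h⟩,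
    fun ρ hρ => entropyChain_nonneg hρ, fun E s hne => ?_⟩
  have hH := totalHamiltonian_isHermitian hh
  have hstate : ∀ ρ ∈ separableClass h E s, IsState ρ := fun ρ => isState_of_mem_separableClass
  have hβ' : 0 < β⁻¹ := inv_pos.2 hβ
  obtain ⟨ρ₀, hρ₀⟩ := id hne
  have : Nonempty (∀ k, α k) := by
    by_contra hempty
    rw [not_nonempty_iff] at hempty
    simpa using (hstate _ hρ₀).2
  have hle : ∀ ρ ∈ separableClass h E s,
      freeEnergy β (totalHamiltonian h) ρ ≤ classicalFreeEnergy β E s := fun ρ hρ => by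
    rw [freeEnergy_of_mem_separableClass β hρ]
    linarith [mul_nonneg hβ'.le (entropyChain_nonneg hρ.1)]
  have hgibbs : freeEnergy β (totalHamiltonian h) (gibbs β (totalHamiltonian h)) ≤
      classicalFreeEnergy β E s :=
    (freeEnergy_gibbs_le hH hβ (hstate _ hρ₀)).trans (hle _ hρ₀)
  have hcF := isCompact_feasibleEnergies β (totalHamiltonian h) (classicalFreeEnergy β E s)
  have hneF : (feasibleEnergies β (totalHamiltonian h) (classicalFreeEnergy β E s)).Nonempty :=
    ⟨_, ρ₀, hstate _ hρ₀, hle _ hρ₀, rfl⟩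
  have hcS : IsCompact (classicalHeatValues β h E s) := by
    rw [classicalHeatValues_eq_image]
    exact hcF.image (by fun_prop)
  have hneS : (classicalHeatValues β h E s).Nonempty := by
    rw [classicalHeatValues_eq_image]
    exact hneF.image _
  have hleast : IsLeast (classicalHeatValues β h E s) (QcStar β h E s) := hcS.isLeast_sInf hneS
  have hgreatest : IsGreatest (classicalHeatValues β h E s) (QhStar β h E s) :=
    hcS.isGreatest_sSup hneS
  have hclassc : IsLeast (Qc β (totalHamiltonian h) '' separableClass h E s) (QcClass β h E s) :=
    isLeast_sInf_image_Qc (isCompact_separableClass h E s) hne hstate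
  have hclassh : IsGreatest (Qh β (totalHamiltonian h) '' separableClass h E s)
      (QhClass β h E s) :=
    isGreatest_sSup_image_Qh (isCompact_separableClass h E s) hne hstate
  have hsub : ∀ ρ ∈ separableClass h E s,
      heatValues β (totalHamiltonian h) ρ ⊆ classicalHeatValues β h E s := by
    rintro ρ hρ _ ⟨η, hη, hηle, rfl⟩
    refine ⟨η, hη, hηle.trans (hle ρ hρ), ?_⟩
    rw [← energy_of_mem_separableClass hρ, ← energy_sub_right, energy]
  have hc : ∀ ρ ∈ separableClass h E s, QcStar β h E s ≤ Qc β (totalHamiltonian h) ρ :=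
    fun ρ hρ => hleast.2 (hsub ρ hρ (isLeast_Qc (hstate ρ hρ)).1)
  have hh' : ∀ ρ ∈ separableClass h E s, Qh β (totalHamiltonian h) ρ ≤ QhStar β h E s :=
    fun ρ hρ => hgreatest.2 (hsub ρ hρ (isGreatest_Qh (hstate ρ hρ)).1)
  have hclassc_le : QcStar β h E s ≤ QcClass β h E s := by
    obtain ⟨ρ, hρ, he⟩ := hclassc.1
    exact he ▸ hc ρ hρ
  have hclassh_le : QhClass β h E s ≤ QhStar β h E s := by
    obtain ⟨ρ, hρ, he⟩ := hclassh.1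
    exact he ▸ hh' ρ hρ
  have hzc : ∀ x ≤ β, thermalGap β (totalHamiltonian h) x (classicalFreeEnergy β E s) = 0 →
      QcStar β h E s = β⁻¹ * (s (Fin.last n) - entropy (gibbs x (totalHamiltonian h))) :=
    fun x hx h0 => by
      rw [QcStar_eq (isGreatest_feasibleEnergies hH hβ hx h0), sum_sub_energy_gibbs h0]
  have hzh : ∀ x ≥ β, thermalGap β (totalHamiltonian h) x (classicalFreeEnergy β E s) = 0 →
      QhStar β h E s = β⁻¹ * (s (Fin.last n) - entropy (gibbs x (totalHamiltonian h))) :=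
    fun x hx h0 => by
      rw [QhStar_eq (isLeast_feasibleEnergies hH hβ hx h0), sum_sub_energy_gibbs h0]
  refine ⟨fun ρ hρ => ⟨hle ρ hρ, ?_, isLeast_Qc (hstate ρ hρ), isGreatest_Qh (hstate ρ hρ),
      hc ρ hρ, hh' ρ hρ, fun q hq => ?_, fun hchain => ?_⟩,
    hclassc, hclassh, hclassc_le, hclassh_le, hleast, hgreatest, ?_, hzc, hzh, ?_, ?_⟩
  · rw [freeEnergy_of_mem_separableClass β hρ, sub_eq_self, mul_eq_zero]
    exact or_iff_right hβ'.ne'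
  · have hq' := hq.mem_heatValues hβ (hstate ρ hρ)
    exact ⟨(isLeast_Qc (hstate ρ hρ)).2 hq', (isGreatest_Qh (hstate ρ hρ)).2 hq'⟩
  · have heq : heatValues β (totalHamiltonian h) ρ = classicalHeatValues β h E s := by
      rw [heatValues_eq_image, classicalHeatValues_eq_image, energy_of_mem_separableClass hρ,
        freeEnergy_of_mem_separableClass β hρ, hchain, mul_zero, sub_zero]
    have ec : Qc β (totalHamiltonian h) ρ = QcStar β h E s := congrArg sInf heq
    have eh : Qh β (totalHamiltonian h) ρ = QhStar β h E s := congrArg sSup heq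
    exact ⟨ec, eh, le_antisymm (ec ▸ hclassc.2 ⟨ρ, hρ, rfl⟩) hclassc_le,
      le_antisymm hclassh_le (eh ▸ hclassh.2 ⟨ρ, hρ, rfl⟩)⟩
  · intro x₁ x₂ hx h1 h2
    have he : freeEnergy β (totalHamiltonian h) (gibbs x₁ (totalHamiltonian h)) =
        freeEnergy β (totalHamiltonian h) (gibbs x₂ (totalHamiltonian h)) :=
      (sub_eq_zero.1 h1).symm.trans (sub_eq_zero.1 h2)
    rcases gibbs_eq_or_mem_Icc hH hβ hx he with hconst | ⟨hx1, hx2⟩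
    · -- all thermal states coincide, so `β` itself is a zero
      have hz : thermalGap β (totalHamiltonian h) β (classicalFreeEnergy β E s) = 0 := by
        rw [thermalGap, hconst β]; exact h1
      rw [hzc β le_rfl hz, hzh β le_rfl hz, hconst β, hconst x₂]
      exact ⟨rfl, rfl⟩
    · exact ⟨hzc x₁ hx1 h1, hzh x₂ hx2 h2⟩
  · intro hno
    obtain ⟨M, hM, hlub⟩ := isLUB_feasibleEnergies hH hgibbs hno
    have hG := hcF.isGreatest_sSup hneF
    exact ⟨M, hM, QcStar_eq (hG.isLUB.unique hlub ▸ hG)⟩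
  · intro hno
    obtain ⟨m, hm, hglb⟩ := isGLB_feasibleEnergies hH hgibbs hno
    have hG := hcF.isLeast_sInf hneF
    exact ⟨m, hm, QhStar_eq (hG.isGLB.unique hglb ▸ hG)⟩
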